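/- **Setting (time).** Let $T\ge 1$, $n\ge 1$, $\Delta t=T/n$, $t_k=k\Delta t$, and let $\alpha:[0,T]\to[\underline\alpha,\overline\alpha]\subset(0,1)$. For $0\le k\le n-1$ let $\sigma_k\in(\tfrac12,1)$ satisfy $\sigma_k=1-\tfrac12\alpha(t_k+\sigma_k\Delta t)$, and write $t_{k+\sigma_k}=t_k+\sigma_k\Delta t$, $\alpha_k^*=\alpha(t_{k+\sigma_k})$. **Exponential sum with tolerance $\epsilon$.** Let $0<\epsilon\le 1/e$, $h=2\pi/\big(\log 3+\overline\alpha\log(\cos 1)^{-1}+\log\epsilon^{-1}\big)$, $\lambda_i=e^{ih}$, $\theta_i^{(k)}=h\,e^{\alpha_k^* i h}/\Gamma(\alpha_k^*)$, and let $\underline N,\overline N$ be integers for which the exponential sum has relative accuracy $\epsilon$: for all $1\le k\le n-1$ and $\tau\in[0,t_{k-1}]$, with $x=(t_{k+\sigma_k}-\tau)/T$, $$\Big|x^{-\alpha_k^*}-\sum_{i=\underline N+1}^{\overline N}\theta_i^{(k)}e^{-\lambda_i x}\Big|\le \epsilon\,x^{-\alpha_k^*}.$$ For a sequence $v^0,\dots,v^n$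 and $0\le k\le n-1$ put $$D^kv=\frac{T^{-\alpha_k^*}}{\Gamma(1-\alpha_k^*)}\sum_{i=\underline N+1}^{\overline N}\theta_i^{(k)}H_i^{(k)}+\frac{\Delta t^{-\alpha_k^*}}{\Gamma(2-\alpha_k^*)}\,\sigma_k^{1-\alpha_k^*}(v^{k+1}-v^k),$$ where $H_i^{(0)}=0$ and, for $k\ge1$, $H_i^{(k)}=e^{-\lambda_i(1+\sigma_k-\sigma_{k-1})\Delta t/T}H_i^{(k-1)}+A_i^{(k)}(v^k-v^{k-1})+B_i^{(k)}(v^{k+1}-v^k)$ with $$A_i^{(k)}=\int_0^1(\tfrac32-\tau)e^{-\lambda_i(\sigma_k+1-\tau)\Delta t/T}d\tau,\qquad B_i^{(k)}=\int_0^1(\tau-\tfrac12)e^{-\lambda_i(\sigma_k+1-\tau)\Delta t/T}d\tau .$$ **Setting (space).** Let $d\ge1$, $\Omega=\prod_{r=1}^d(a_l^{(r)},a_r^{(r)})$, $m^{(r)}\ge1$, $\Delta x^{(r)}=(a_r^{(r)}-a_l^{(r)})/m^{(r)}$, with grid points $\mathbf x_j$, $0\le j^{(r)}\le m^{(r)}$;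 let $\mathcal J$ be the set of interior indices ($1\le j^{(r)}\le m^{(r)}-1$ for all $r$) and $\partial\mathcal J$ the set of the remaining ones. Let $e_r$ be the $r$-th unit index, $\delta_r^2u_j=(u_{j+e_r}-2u_j+u_{j-e_r})/(\Delta x^{(r)})^2$, $\mathcal A_ru_j=\frac1{12}(u_{j-e_r}+10u_j+u_{j+e_r})$ for $j\in\mathcal J$ and $\mathcal A_ru_j=u_j$ for $j\in\partial\mathcal J$; $\Delta_h=\sum_r\delta_r^2$, $\mathcal A_h=\mathcal A_1\cdots\mathcal A_d$, $\Lambda_h=\sum_r\big(\prod_{l\ne r}\mathcal A_l\big)\delta_r^2$. Put $(u,w)=\big(\prod_r\Delta x^{(r)}\big)\sum_{j\in\mathcal J}u_jw_j$, $\|u\|=\sqrt{(u,u)}$ and $|u|_{1,\mathcal A_h}=\sqrt{(\mathcal A_hu,-\Delta_hu)}$. **Theorem.** Assume moreover that $$\epsilon\le\frac{2(1-\overline\alpha)(2-\frac12\overline\alpha)^{1-\overline\alpha}\Delta t^{\overline\alpha}}{(6-\frac72\underline\alpha)(1-\frac12\underline\alpha)} .$$ Let $f$ and $\varphi$ be given,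 $f_j^{k+\sigma_k}=f(\mathbf x_j,t_{k+\sigma_k})$, and let $\{u_j^k\}$ be a solution of the fast $L2$-$1_\sigma$ (FL2-$1_\sigma$) compact difference scheme $$\mathcal A_h(D^ku)_j=\Lambda_h\big(\sigma_ku_j^{k+1}+(1-\sigma_k)u_j^k\big)+\mathcal A_hf_j^{k+\sigma_k}\quad(j\in\mathcal J,\ 0\le k\le n-1),$$ with $u_j^0=\varphi(\mathbf x_j)$ for $j\in\mathcal J$ and $u_j^k=0$ for $j\in\partial\mathcal J$, $0\le k\le n$. Then, for all $0\le k\le n$, $$|u^k|_{1,\mathcal A_h}^2\le|u^0|_{1,\mathcal A_h}^2+\Big(\frac32\Big)^{d-1}\frac1{1-\epsilon}\,c_1\max_{0\le l\le k-1}\|\mathcal A_hf^{l+\sigma_l}\|^2,\qquad c_1=\sup_{0\le t\le T}t^{\alpha(t)}\Gamma(1-\alpha(t)),$$ where the maximum over the empty set (for $k=0$) is $0$; when $\alpha$ is continuous the supremum is a maximum. There is no relation between the time step and the mesh widths. -/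

import Mathlib

noncomputable section

namespace FL2

/-- Data of the time discretization and of the exponential sum: final time `T`, number of time
steps `n`, variable order `α`, offsets `σ k`, quadrature step `h` and truncation indices `Nlo`, `Nhi`
(the sum runs over `Nlo < i ≤ Nhi`). -/
structure TimeData where
  T : ℝ
  n : ℕ
  α : ℝ → ℝ
  σ : ℕ → ℝ
  h : ℝ
  Nlo : ℤ
  Nhi : ℤ

namespace TimeData

variable (P : TimeData)

/-- The time step `Δt = T / n`. -/
def dt : ℝ := P.T / P.n

/-- The time level `t_k = k Δt`. -/
def t (k : ℕ) : ℝ := k * P.dt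

/-- The shifted time `t_{k+σ_k} = t_k + σ_k Δt`. -/
def tσ (k : ℕ) : ℝ := P.t k + P.σ k * P.dt

/-- The order `α_{k+σ_k} = α(t_{k+σ_k})`. -/
def ασ (k : ℕ) : ℝ := P.α (P.tσ k)

/-- For every `k < n`, the offset `σ_k` is a root in `(1/2, 1)` of `σ = 1 - α(t_k + σ Δt) / 2`. -/
def IsOffset : Prop :=
  ∀ k < P.n, 1 / 2 < P.σ k ∧ P.σ k < 1 ∧ P.σ k = 1 - P.α (P.t k + P.σ k * P.dt) / 2

/-- The quadrature exponent `λ_i = e^{ih}`. -/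
def lam (i : ℤ) : ℝ := Real.exp (i * P.h)

/-- The quadrature weight `θ_i^{(k)} = h e^{α_{k+σ_k} i h} / Γ(α_{k+σ_k})`. -/
def θ (k : ℕ) (i : ℤ) : ℝ := P.h * Real.exp (P.ασ k * i * P.h) / Real.Gamma (P.ασ k)

/-- The exponential sum has relative accuracy `ε`: for `1 ≤ k ≤ n - 1` and `τ ∈ [0, t_{k-1}]`, with
`x = (t_{k+σ_k} - τ) / T`, one has `|x^{-α_{k+σ_k}} - ∑ θ_i^{(k)} e^{-λ_i x}| ≤ ε x^{-α_{k+σ_k}}`. -/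
def HasAccuracy (ε : ℝ) : Prop :=
  ∀ k, 1 ≤ k → k < P.n → ∀ τ ∈ Set.Icc 0 (P.t (k - 1)),
    |((P.tσ k - τ) / P.T) ^ (-P.ασ k)
        - ∑ i ∈ Finset.Ioc P.Nlo P.Nhi, P.θ k i * Real.exp (-P.lam i * (P.tσ k - τ) / P.T)|
      ≤ ((P.tσ k - τ) / P.T) ^ (-P.ασ k) * ε

/-- `A_i^{(k)} = ∫₀¹ (3/2 - τ) e^{-λ_i (σ_k + 1 - τ) Δt / T} dτ`. -/
def coefA (k : ℕ) (i : ℤ) : ℝ :=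
  ∫ τ in (0 : ℝ)..1, (3 / 2 - τ) * Real.exp (-P.lam i * (P.σ k + 1 - τ) * P.dt / P.T)

/-- `B_i^{(k)} = ∫₀¹ (τ - 1/2) e^{-λ_i (σ_k + 1 - τ) Δt / T} dτ`. -/
def coefB (k : ℕ) (i : ℤ) : ℝ :=
  ∫ τ in (0 : ℝ)..1, (τ - 1 / 2) * Real.exp (-P.lam i * (P.σ k + 1 - τ) * P.dt / P.T)

/-- The history part `H_i^{(k)}` of a sequence `v`, through its two-term recursion. -/
def hist (v : ℕ → ℝ) (i : ℤ) : ℕ → ℝ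
  | 0 => 0
  | k + 1 =>
      Real.exp (-P.lam i * (1 + P.σ (k + 1) - P.σ k) * P.dt / P.T) * hist v i k
        + P.coefA (k + 1) i * (v (k + 1) - v k) + P.coefB (k + 1) i * (v (k + 2) - v (k + 1))

/-- `s^{(k)} = Δt^{-α_{k+σ_k}} / Γ(2 - α_{k+σ_k})`. -/
def s (k : ℕ) : ℝ := P.dt ^ (-P.ασ k) / Real.Gamma (2 - P.ασ k)

/-- The fast discrete fractional derivative of the sequence `v` at the time `t_{k+σ_k}`. -/
def fastDeriv (v : ℕ → ℝ) (k : ℕ) : ℝ :=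
  P.T ^ (-P.ασ k) / Real.Gamma (1 - P.ασ k)
      * ∑ i ∈ Finset.Ioc P.Nlo P.Nhi, P.θ k i * P.hist v i k
    + P.s k * P.σ k ^ (1 - P.ασ k) * (v (k + 1) - v k)

/-- `c₁ = max_{0 ≤ t ≤ T} t^{α(t)} Γ(1 - α(t))`, written as a supremum. -/
def c₁ : ℝ := sSup ((fun t : ℝ => t ^ P.α t * Real.Gamma (1 - P.α t)) '' Set.Icc 0 P.T)

end TimeData

/-- The quadrature step `h = 2π / (log 3 + ᾱ log (cos 1)⁻¹ + log ε⁻¹)`. -/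
def quadStep (αmax ε : ℝ) : ℝ :=
  2 * Real.pi / (Real.log 3 + αmax * Real.log (Real.cos 1)⁻¹ + Real.log ε⁻¹)

/-- The bound on the tolerance:
`2 (1 - ᾱ) (2 - ᾱ/2)^{1 - ᾱ} Δt^{ᾱ} / ((6 - (7/2) α̲) (1 - α̲/2))`. -/
def toleranceBound (αmin αmax dt : ℝ) : ℝ :=
  2 * (1 - αmax) * (2 - αmax / 2) ^ (1 - αmax) * dt ^ αmax
    / ((6 - 7 / 2 * αmin) * (1 - αmin / 2))

/-- A box `∏ (aL i, aR i)` in `ℝ^d` with `m i` cells in the `i`-th direction. -/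
structure Grid (d : ℕ) where
  aL : Fin d → ℝ
  aR : Fin d → ℝ
  m : Fin d → ℕ

namespace Grid

variable {d : ℕ} (g : Grid d)

/-- The mesh width `Δx^{(i)} = (aR i - aL i) / m i`. -/
def dx (i : Fin d) : ℝ := (g.aR i - g.aL i) / g.m i

/-- The grid point with index vector `j`. -/
def point (j : Fin d → ℤ) : Fin d → ℝ := fun i => g.aL i + j i * g.dx i

/-- Index vectors of all grid points, `0 ≤ j i ≤ m i`. -/
def allIdx : Finset (Fin d → ℤ) := Fintype.piFinset fun i => Finset.Icc 0 (g.m i : ℤ)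

/-- Index vectors of the interior grid points, `1 ≤ j i ≤ m i - 1`. -/
def intIdx : Finset (Fin d → ℤ) := Fintype.piFinset fun i => Finset.Icc 1 ((g.m i : ℤ) - 1)

/-- Index vectors of the boundary grid points. -/
def bdryIdx : Finset (Fin d → ℤ) := g.allIdx \ g.intIdx

/-! Grid functions are real functions on `Fin d → ℤ`; only the values on `allIdx` matter below. -/

/-- The second difference quotient `δ_i²`. -/
def secondDiff (i : Fin d) (v : (Fin d → ℤ) → ℝ) (j : Fin d → ℤ) : ℝ :=
  (v (j + Pi.single i 1) - 2 * v j + v (j - Pi.single i 1)) / g.dx i ^ 2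

/-- The discrete Laplacian `Δ_h`. -/
def lap (v : (Fin d → ℤ) → ℝ) (j : Fin d → ℤ) : ℝ := ∑ i, g.secondDiff i v j

/-- The averaging operator `𝒜_i`: the compact average at interior points and the identity at
boundary points. -/
def avg (i : Fin d) (v : (Fin d → ℤ) → ℝ) (j : Fin d → ℤ) : ℝ :=
  if j ∈ g.intIdx then (v (j - Pi.single i 1) + 10 * v j + v (j + Pi.single i 1)) / 12 else v j

/-- The composition of the averaging operators in the directions of a list, first element
outermost. -/
def avgList (l : List (Fin d)) (v : (Fin d → ℤ) → ℝ) : (Fin d → ℤ) → ℝ :=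
  l.foldr (fun i w => g.avg i w) v

/-- `𝒜_h = 𝒜_1 𝒜_2 ⋯ 𝒜_d`. -/
def avgAll (v : (Fin d → ℤ) → ℝ) : (Fin d → ℤ) → ℝ := g.avgList (List.finRange d) v

/-- `Λ_h = ∑_i (∏_{l ≠ i} 𝒜_l) δ_i²`. -/
def compactLap (v : (Fin d → ℤ) → ℝ) (j : Fin d → ℤ) : ℝ :=
  ∑ i, g.avgList ((List.finRange d).filter fun l => l ≠ i) (g.secondDiff i v) j

/-- The discrete inner product `(v, w) = (∏ Δx^{(r)}) ∑_{j interior} v_j w_j`. -/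
def ip (v w : (Fin d → ℤ) → ℝ) : ℝ := (∏ r, g.dx r) * ∑ j ∈ g.intIdx, v j * w j

/-- `‖v‖ = √(v, v)`. -/
def norm (v : (Fin d → ℤ) → ℝ) : ℝ := √(g.ip v v)

/-- `⟨v, w⟩_{𝒜_h} = (𝒜_h v, -Δ_h w)`. -/
def ipA (v w : (Fin d → ℤ) → ℝ) : ℝ := g.ip (g.avgAll v) (fun j => -g.lap w j)

/-- `|v|_{1,𝒜_h} = √⟨v, v⟩_{𝒜_h}`. -/
def normA (v : (Fin d → ℤ) → ℝ) : ℝ := √(g.ipA v v)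

/-- The grid function `f^{k+σ_k}`, that is `j ↦ f(x_j, t_{k+σ_k})`. -/
def source (P : TimeData) (f : (Fin d → ℝ) → ℝ → ℝ) (k : ℕ) (j : Fin d → ℤ) : ℝ :=
  f (g.point j) (P.tσ k)

/-- `u k j`, for `0 ≤ k ≤ n` and grid indices `j`, solves the fast compact difference scheme with
initial value `φ`, source `f` and homogeneous Dirichlet boundary values. -/
structure IsSolution (P : TimeData) (φ : (Fin d → ℝ) → ℝ) (f : (Fin d → ℝ) → ℝ → ℝ)
    (u : ℕ → (Fin d → ℤ) → ℝ) : Prop where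
  step : ∀ k < P.n, ∀ j ∈ g.intIdx,
    g.avgAll (fun i => P.fastDeriv (fun l => u l i) k) j
      = g.compactLap (fun i => P.σ k * u (k + 1) i + (1 - P.σ k) * u k i) j
        + g.avgAll (g.source P f k) j
  initial : ∀ j ∈ g.intIdx, u 0 j = φ (g.point j)
  boundary : ∀ k ≤ P.n, ∀ j ∈ g.bdryIdx, u k j = 0

end Grid

end FL2

end

/-! Written out, the fast derivative is `∑_{j ≤ k} G_j (v^{j+1} - v^j)` with weights `G_j = weight k
j`. Stability follows from three facts about them: they are nondecreasing in `j`; the last two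
satisfy `σ² G_{k-1} ≤ (2σ - 1) G_k` (`weight_last`); and `G_0 ≥ (1 - ε) t_{k+σ}^{-α} / Γ(1 - α) ≥ (1
- ε) / c₁` (`weight_zero_ge`).

The first two give `∑ G_j (E_{j+1} - E_j) ≤ 2⟨Du, u^σ⟩` for the energies `E_j` of the form
`⟨·,·⟩_{𝒜_h}` (`sum_sub_le_two_mul_form`). Pairing the scheme with `-Δ_h u^σ` bounds the right side
by the source (`ipA_le_of_compact_eq`): all spatial operators are polynomials in commuting positive
semidefinite matrices and every `𝒜_i ≥ 2/3`, so `-Λ_h ≥ (2/3)^{d-1} (-Δ_h)`, and Young's inequality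
applies. The lower bound on `G_0` then closes a Grönwall argument (`le_add_div_of_sum_le`).

The delicate point is `weight_last`. It needs an upper bound for the exponential sum at the lag `σ
Δt`, where the accuracy assumption says nothing. All terms are positive, so the truncated sum is at
most the sum over all integers, which Poisson summation compares with the power function: the zero
frequency gives exactly `x^{-α}`, and the others are values of `Γ` at `α + 2πin/h`, exponentially
small relative to `Γ(α)`. The relative excess `α/2` suffices because `σ (1 + α/2) = 1 - α²/4`. -/

namespace FL2

/-! ### Decay of the Gamma function along vertical lines. -/

section GammaDecay

/-- Along a vertical line the Gamma function decays at least as fast as on any line further to the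
right, relative to the values on the real axis. -/
theorem norm_Gamma_le_mul_norm_Gamma_add {x t : ℝ} (hx : 0 < x) (ht : 0 < t) (y : ℝ) :
    ‖Complex.Gamma (x + y * Complex.I)‖
      ≤ Real.Gamma x / Real.Gamma (x + t) * ‖Complex.Gamma (x + t + y * Complex.I)‖ := by
  have hre : (x + y * Complex.I : ℂ).re = x := by simp
  have h1 := Complex.Gamma_mul_Gamma_eq_betaIntegral (s := x + y * Complex.I) (t := t)
    (by rw [hre]; exact hx) (by simpa using ht)
  have h2 := Complex.Gamma_mul_Gamma_eq_betaIntegral (s := x) (t := t)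
    (by simpa using hx) (by simpa using ht)
  -- The phase `v^{iy}` has modulus one, so the Beta integral is largest on the real axis.
  have hB : ‖Complex.betaIntegral (x + y * Complex.I) t‖ ≤ ‖Complex.betaIntegral x t‖ := by
    have hpos : ∀ v ∈ Set.Ioo (0 : ℝ) 1,
        ((v : ℂ) ^ ((x : ℂ) - 1) * (1 - v : ℂ) ^ ((t : ℂ) - 1))
          = ((v ^ (x - 1) * (1 - v) ^ (t - 1) : ℝ) : ℂ) := by
      intro v hv
      push_cast
      rw [Complex.ofReal_cpow hv.1.le, Complex.ofReal_cpow (by linarith [hv.2])]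
      push_cast
      rfl
    have hnorm : ∀ v ∈ Set.Ioo (0 : ℝ) 1,
        ‖((v : ℂ) ^ ((x + y * Complex.I : ℂ) - 1) * (1 - v : ℂ) ^ ((t : ℂ) - 1))‖
          = v ^ (x - 1) * (1 - v) ^ (t - 1) := by
      intro v hv
      have hv' : 0 < 1 - v := by linarith [hv.2]
      rw [norm_mul, Complex.norm_cpow_eq_rpow_re_of_pos hv.1,
        show (1 - v : ℂ) = ((1 - v : ℝ) : ℂ) by push_cast; rfl,
        Complex.norm_cpow_eq_rpow_re_of_pos hv']
      simp
    have e2 : Complex.betaIntegral x t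
        = ((∫ v in (0 : ℝ)..1, v ^ (x - 1) * (1 - v) ^ (t - 1) : ℝ) : ℂ) := by
      rw [Complex.betaIntegral, ← intervalIntegral.integral_ofReal]
      rw [intervalIntegral.integral_of_le zero_le_one, intervalIntegral.integral_of_le zero_le_one,
        MeasureTheory.integral_Ioc_eq_integral_Ioo, MeasureTheory.integral_Ioc_eq_integral_Ioo]
      exact MeasureTheory.setIntegral_congr_fun measurableSet_Ioo hpos
    have e1 : ‖Complex.betaIntegral (x + y * Complex.I) t‖
        ≤ ∫ v in (0 : ℝ)..1, v ^ (x - 1) * (1 - v) ^ (t - 1) := by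
      rw [Complex.betaIntegral]
      refine (intervalIntegral.norm_integral_le_integral_norm zero_le_one).trans (le_of_eq ?_)
      rw [intervalIntegral.integral_of_le zero_le_one, intervalIntegral.integral_of_le zero_le_one,
        MeasureTheory.integral_Ioc_eq_integral_Ioo, MeasureTheory.integral_Ioc_eq_integral_Ioo]
      exact MeasureTheory.setIntegral_congr_fun measurableSet_Ioo hnorm
    rw [e2, Complex.norm_real]
    exact e1.trans (le_abs_self _)
  have g1 := congrArg norm h1
  have g2 := congrArg norm h2
  rw [norm_mul, norm_mul] at g1 g2
  rw [← Complex.ofReal_add, Complex.Gamma_ofReal, Complex.Gamma_ofReal, Complex.Gamma_ofReal,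
    Complex.norm_real, Complex.norm_real, Complex.norm_real, Real.norm_eq_abs, Real.norm_eq_abs,
    Real.norm_eq_abs, abs_of_pos (Real.Gamma_pos_of_pos hx), abs_of_pos (Real.Gamma_pos_of_pos ht),
    abs_of_pos (Real.Gamma_pos_of_pos (add_pos hx ht))] at g2
  rw [Complex.Gamma_ofReal, Complex.norm_real, Real.norm_eq_abs,
    abs_of_pos (Real.Gamma_pos_of_pos ht)] at g1
  have hxt := Real.Gamma_pos_of_pos (add_pos hx ht)
  have hgt := Real.Gamma_pos_of_pos ht
  have hco : (x + y * Complex.I + t : ℂ) = x + t + y * Complex.I := by ring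
  rw [hco] at g1
  have hN := norm_nonneg (Complex.Gamma (x + t + y * Complex.I))
  have : ‖Complex.Gamma (x + y * Complex.I)‖ * Real.Gamma t * Real.Gamma (x + t)
      ≤ Real.Gamma x * ‖Complex.Gamma (x + t + y * Complex.I)‖ * Real.Gamma t := by
    rw [g1, mul_right_comm (Real.Gamma x), g2]
    have := mul_le_mul_of_nonneg_left hB (mul_nonneg hN hxt.le)
    nlinarith
  rw [div_mul_eq_mul_div, le_div_iff₀ hxt]
  nlinarith

/-- Reflection formula, together with `Γ(1 - iy)` being the conjugate of `Γ(1 + iy)`. -/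
theorem norm_Gamma_one_add_mul_I_sq {y : ℝ} (hy : y ≠ 0) :
    ‖Complex.Gamma (1 + y * Complex.I)‖ ^ 2 = Real.pi * y / Real.sinh (Real.pi * y) := by
  have hI : (y * Complex.I : ℂ) ≠ 0 := mul_ne_zero (by exact_mod_cast hy) Complex.I_ne_zero
  have h1 : Complex.Gamma (1 + y * Complex.I) * Complex.Gamma (1 - y * Complex.I)
      = ((Real.pi * y / Real.sinh (Real.pi * y) : ℝ) : ℂ) := by
    rw [add_comm, Complex.Gamma_add_one _ hI, mul_assoc, Complex.Gamma_mul_Gamma_one_sub,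
      ← mul_assoc, Complex.sin_mul_I]
    push_cast
    rw [mul_div_assoc', mul_comm (Complex.sinh _), mul_right_comm, mul_comm (y * (Real.pi : ℂ)),
      mul_div_mul_left _ _ Complex.I_ne_zero, mul_comm (y : ℂ)]
  have h2 : Complex.Gamma (1 - y * Complex.I)
      = (starRingEnd ℂ) (Complex.Gamma (1 + y * Complex.I)) := by
    rw [← Complex.Gamma_conj]; simp [sub_eq_add_neg]
  rw [h2, Complex.mul_conj, Complex.ofReal_inj, Complex.normSq_eq_norm_sq] at h1
  exact h1

theorem norm_Gamma_two_add_mul_I_sq {y : ℝ} (hy : y ≠ 0) :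
    ‖Complex.Gamma (2 + y * Complex.I)‖ ^ 2
      = (1 + y ^ 2) * (Real.pi * y / Real.sinh (Real.pi * y)) := by
  have hne : (1 + y * Complex.I : ℂ) ≠ 0 := fun h => by simpa using congrArg Complex.re h
  rw [show (2 + y * Complex.I : ℂ) = 1 + y * Complex.I + 1 by ring, Complex.Gamma_add_one _ hne,
    norm_mul, mul_pow, norm_Gamma_one_add_mul_I_sq hy, ← Complex.normSq_eq_norm_sq,
    Complex.normSq_apply]
  simp [sq]

/-- Half of the exponential decay is spent on absorbing `u`, via `3.5 u ≤ e^{u/2}`. The threshold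
6.28 corresponds to `u = πy` with `y ≥ 2`; 1.715 is 3.5/2 less a margin for the `e^{-u}` in `sinh`.
-/
theorem div_sinh_le {u : ℝ} (hu : 6.28 ≤ u) : u / Real.sinh u ≤ Real.exp (-(u / 2)) / 1.715 := by
  have h1 : (3.5 * u) ≤ Real.exp (u / 2) := by
    have e1 : (23 : ℝ) ≤ Real.exp 3.14 := by
      have : Real.exp 3.14 = Real.exp 1 ^ 3 * Real.exp 0.14 := by
        rw [← Real.exp_nat_mul, ← Real.exp_add]; norm_num
      rw [this]
      have a := Real.exp_one_gt_d9
      have b := Real.add_one_le_exp 0.14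
      have c : (2.718 : ℝ) ^ 3 ≤ Real.exp 1 ^ 3 := by gcongr; linarith
      have := Real.quadratic_le_exp_of_nonneg (x := 0.14) (by norm_num)
      nlinarith
    have e2 : Real.exp (u / 2) = Real.exp 3.14 * Real.exp (u / 2 - 3.14) := by
      rw [← Real.exp_add]; ring_nf
    rw [e2]
    have := Real.add_one_le_exp (u / 2 - 3.14)
    nlinarith [Real.exp_pos (u / 2 - 3.14)]
  have h2 : Real.exp u = Real.exp (u / 2) * Real.exp (u / 2) := by
    rw [← Real.exp_add]; ring_nf
  have h3 : Real.exp (-u) ≤ 1 := Real.exp_le_one_iff.2 (by linarith)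
  have hp := Real.exp_pos (u / 2)
  have h4 : 1.715 * u * Real.exp (u / 2) ≤ Real.sinh u := by
    rw [Real.sinh_eq, h2]
    nlinarith
  have h5 : 0 < 1.715 * u * Real.exp (u / 2) := by positivity
  rw [Real.exp_neg, div_le_div_iff₀ (h5.trans_le h4) (by norm_num)]
  rw [← div_eq_inv_mul, le_div_iff₀ hp]
  linarith

/-- Exponential decay of `Γ(α + i y)` relative to `Γ(α)`, with a factor that is small for small
`α`. -/
theorem norm_Gamma_le_exp {α y : ℝ} (h0 : 0 < α) (h1 : α < 1) (hy : 2 ≤ |y|) :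
    ‖Complex.Gamma (α + y * Complex.I)‖
      ≤ Real.Gamma α * α * 0.854 * Real.exp (-(Real.pi * |y| / 4)) := by
  wlog hpos : 0 ≤ y generalizing y with H
  · have := H (y := -y) (by simpa using hy) (by linarith)
    rw [abs_neg] at this
    rwa [show (α + (-y : ℝ) * Complex.I : ℂ) = (starRingEnd ℂ) (α + y * Complex.I) by simp,
      Complex.Gamma_conj, Complex.norm_conj] at this
  rw [abs_of_nonneg hpos] at hy ⊢
  have hy0 : 0 < y := by linarith
  have hz : (α + y * Complex.I : ℂ) ≠ 0 := fun h => by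
    have := congrArg Complex.re h; simp at this; linarith
  have hzn : y ≤ ‖(α + y * Complex.I : ℂ)‖ := by
    have := Complex.abs_im_le_norm (α + y * Complex.I)
    simp at this
    exact (le_abs_self y).trans this
  have hshift : ‖(α + y * Complex.I : ℂ)‖ * ‖Complex.Gamma (α + y * Complex.I)‖
      = ‖Complex.Gamma ((α + 1 : ℝ) + y * Complex.I)‖ := by
    rw [← norm_mul, ← Complex.Gamma_add_one _ hz]
    congr 2; push_cast; ring
  -- Moving first to real part `α + 1` produces the small factor `α`, since `Γ(α + 1) = α Γ(α)`.
  -- Moving on to real part 2 reaches a line where the modulus is explicit.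
  have hbeta := norm_Gamma_le_mul_norm_Gamma_add (x := α + 1) (t := 1 - α) (by linarith)
    (by linarith) y
  rw [show α + 1 + (1 - α) = 2 by ring, Real.Gamma_two, div_one, Real.Gamma_add_one h0.ne',
    show (((α + 1 : ℝ) : ℂ) + ((1 - α : ℝ) : ℂ) + y * Complex.I) = 2 + y * Complex.I by
      push_cast; ring] at hbeta
  have hG := Real.Gamma_pos_of_pos h0
  have hsq : ‖Complex.Gamma (2 + y * Complex.I)‖ ≤ 0.854 * Real.exp (-(Real.pi * y / 4)) * y := by
    refine abs_le_of_sq_le_sq' ?_ (by positivity) |>.2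
    rw [norm_Gamma_two_add_mul_I_sq hy0.ne']
    have hd := div_sinh_le (u := Real.pi * y) (by nlinarith [Real.pi_gt_d2])
    have he : Real.exp (-(Real.pi * y / 2)) = Real.exp (-(Real.pi * y / 4)) ^ 2 := by
      rw [← Real.exp_nat_mul]; congr 1; push_cast; ring
    rw [he] at hd
    calc (1 + y ^ 2) * (Real.pi * y / Real.sinh (Real.pi * y))
        ≤ (1 + y ^ 2) * (Real.exp (-(Real.pi * y / 4)) ^ 2 / 1.715) := by gcongr
      _ ≤ (5 / 4 * y ^ 2) * (Real.exp (-(Real.pi * y / 4)) ^ 2 / 1.715) := by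
        gcongr; nlinarith
      _ = 5 / 4 / 1.715 * (Real.exp (-(Real.pi * y / 4)) ^ 2 * y ^ 2) := by ring
      -- 0.854 is just above the square root of (5/4)/1.715; the 5/4 comes from `y ≥ 2`.
      _ ≤ 0.854 ^ 2 * (Real.exp (-(Real.pi * y / 4)) ^ 2 * y ^ 2) := by gcongr; norm_num
      _ = _ := by ring
  have hfin : y * ‖Complex.Gamma (α + y * Complex.I)‖
      ≤ y * (Real.Gamma α * α * 0.854 * Real.exp (-(Real.pi * y / 4))) := by
    calc _ ≤ ‖(α + y * Complex.I : ℂ)‖ * ‖Complex.Gamma (α + y * Complex.I)‖ := by gcongr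
      _ ≤ α * Real.Gamma α * ‖Complex.Gamma (2 + y * Complex.I)‖ := hshift.le.trans hbeta
      _ ≤ α * Real.Gamma α * (0.854 * Real.exp (-(Real.pi * y / 4)) * y) := by gcongr
      _ = _ := by ring
  exact le_of_mul_le_mul_left hfin hy0

end GammaDecay

end FL2

namespace FL2

/-! ### Poisson summation for the exponential sum over all integers. -/

section PoissonBound

open Filter Asymptotics

/-- The summand of the exponential sum, as a function of a continuous index. -/
noncomputable def expTerm (α h x u : ℝ) : ℝ := Real.exp (-(α * h) * u) * Real.exp (-x * Real.exp (-(h * u)))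

/-- Only negative `u` needs work. With `w = -hu`, the double exponential is used through `e^w ≥
w²/2`, and completing the square gives `2αw ≤ x w²/2 + 2α²/x`. -/
theorem expTerm_le {α h x : ℝ} (hα : 0 < α) (hh : 0 < h) (hx : 0 < x) (u : ℝ) :
    expTerm α h x u ≤ Real.exp (2 * α ^ 2 / x) * Real.exp (-(α * h) * |u|) := by
  rw [expTerm, ← Real.exp_add, ← Real.exp_add, Real.exp_le_exp]
  rcases le_total 0 u with hu | hu
  · rw [abs_of_nonneg hu]
    have : 0 ≤ 2 * α ^ 2 / x := by positivity
    have := mul_pos hx (Real.exp_pos (-(h * u)))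
    linarith
  · rw [abs_of_nonpos hu]
    have hw : 0 ≤ -(h * u) := by nlinarith
    have h1 := Real.quadratic_le_exp_of_nonneg hw
    set w := -(h * u) with hwdef
    have e : -(α * h) * -u = -(α * w) := by rw [hwdef]; ring
    have e' : -(α * h) * u = α * w := by rw [hwdef]; ring
    rw [e, e']
    have h2 : x * (w ^ 2 / 2) ≤ x * Real.exp w := by
      apply mul_le_mul_of_nonneg_left _ hx.le
      linarith
    have h3 : 2 * α * w ≤ x * (w ^ 2 / 2) + 2 * α ^ 2 / x := by
      have : x * (w ^ 2 / 2) + 2 * α ^ 2 / x - 2 * α * w = (x * w - 2 * α) ^ 2 / (2 * x) := by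
        field_simp; ring
      have h4 : 0 ≤ (x * w - 2 * α) ^ 2 / (2 * x) := by positivity
      linarith
    linarith

theorem continuous_expTerm (α h x : ℝ) : Continuous (expTerm α h x) := by
  unfold expTerm; fun_prop

theorem expTerm_isBigO {α h x : ℝ} (hα : 0 < α) (hh : 0 < h) (hx : 0 < x) :
    (fun u : ℝ => (expTerm α h x u : ℂ)) =O[cocompact ℝ] fun u : ℝ => |u| ^ (-2 : ℝ) := by
  have h1 : (fun u : ℝ => (expTerm α h x u : ℂ)) =O[cocompact ℝ]
      fun u : ℝ => Real.exp (-(α * h) * |u|) := by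
    refine IsBigO.of_bound (Real.exp (2 * α ^ 2 / x)) (Eventually.of_forall fun u => ?_)
    rw [Complex.norm_real, Real.norm_eq_abs, Real.norm_eq_abs, abs_of_pos (Real.exp_pos _),
      abs_of_pos (by unfold expTerm; positivity)]
    exact expTerm_le hα hh hx u
  have h2 := (isLittleO_exp_neg_mul_rpow_atTop (mul_pos hα hh) (-2)).comp_tendsto
    (tendsto_norm_cocompact_atTop (E := ℝ))
  exact h1.trans h2.isBigO

theorem mellin_exp_neg_mul {x : ℝ} (hx : 0 < x) {z : ℂ} (hz : 0 < z.re) :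
    mellin (fun t : ℝ => Complex.exp (-(x * t))) z = (1 / x : ℂ) ^ z * Complex.Gamma z := by
  rw [← Complex.integral_cpow_mul_exp_neg_mul_Ioi hz hx]
  rfl

open FourierTransform in
-- With `t = e^{-u}` the Fourier transform becomes the Mellin transform of `exp(-x t^h)` at `αh +
-- 2πiξ`; rescaling the exponent by `h` leaves Euler's integral.
theorem fourier_expTerm {α h x : ℝ} (hα : 0 < α) (hh : 0 < h) (hx : 0 < x) (ξ : ℝ) :
    𝓕 (fun u : ℝ => (expTerm α h x u : ℂ)) ξ
      = (h⁻¹ : ℝ) * ((1 / x : ℂ) ^ (α + (2 * Real.pi / h * ξ : ℝ) * Complex.I)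
        * Complex.Gamma (α + (2 * Real.pi / h * ξ : ℝ) * Complex.I)) := by
  have h1 := mellin_eq_fourier (fun t : ℝ => Complex.exp (-(x * (t ^ h : ℝ))))
    (s := ((α * h : ℝ) + (2 * Real.pi * ξ : ℝ) * Complex.I))
  have h2 := mellin_comp_rpow (fun t : ℝ => Complex.exp (-(x * t)))
    ((α * h : ℝ) + (2 * Real.pi * ξ : ℝ) * Complex.I) h
  have h3 : (((α * h : ℝ) + (2 * Real.pi * ξ : ℝ) * Complex.I) / h : ℂ)
      = α + (2 * Real.pi / h * ξ : ℝ) * Complex.I := by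
    have : (h : ℂ) ≠ 0 := by exact_mod_cast hh.ne'
    push_cast
    field_simp
  rw [h3, mellin_exp_neg_mul hx (by simpa using hα), abs_of_pos hh] at h2
  rw [h2] at h1
  have h4 : (((α * h : ℝ) + (2 * Real.pi * ξ : ℝ) * Complex.I : ℂ)).im / (2 * Real.pi) = ξ := by
    simp
  have h5 : (((α * h : ℝ) + (2 * Real.pi * ξ : ℝ) * Complex.I : ℂ)).re = α * h := by simp
  rw [h4, h5] at h1
  rw [← Complex.real_smul, h1]
  refine congrArg (fun F : ℝ → ℂ => 𝓕 F ξ) (funext fun u => ?_)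
  rw [Complex.real_smul, ← Real.exp_mul, expTerm]
  push_cast
  congr 2
  ring_nf

theorem norm_fourier_expTerm {α h x : ℝ} (hα : 0 < α) (hh : 0 < h) (hx : 0 < x) (ξ : ℝ) :
    ‖FourierTransform.fourier (fun u : ℝ => (expTerm α h x u : ℂ)) ξ‖
      = h⁻¹ * (x ^ (-α) * ‖Complex.Gamma (α + (2 * Real.pi / h * ξ : ℝ) * Complex.I)‖) := by
  rw [fourier_expTerm hα hh hx, norm_mul, norm_mul, Complex.norm_real, Real.norm_eq_abs,
    abs_of_pos (inv_pos.2 hh), show (1 / x : ℂ) = ((1 / x : ℝ) : ℂ) by push_cast; rfl,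
    Complex.norm_cpow_eq_rpow_re_of_pos (by positivity)]
  have : (α + (2 * Real.pi / h * ξ : ℝ) * Complex.I : ℂ).re = α := by simp
  rw [this, one_div, Real.inv_rpow hx.le, Real.rpow_neg hx.le]

/-- The exponential sum over all integers overestimates the power function by a relative error of
at most `α / 2`, once the step satisfies `2 ≤ 2π / h`. -/
theorem sum_expTerm_le {α h x : ℝ} (hα : 0 < α) (hα1 : α < 1) (hh : 0 < h) (hx : 0 < x)
    (hY : 2 ≤ 2 * Real.pi / h) (s : Finset ℤ) :
    h * ∑ i ∈ s, expTerm α h x i ≤ Real.Gamma α * (1 + α / 2) * x ^ (-α) := by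
  set c : ℤ → ℝ := fun n =>
    ‖FourierTransform.fourier (fun u : ℝ => (expTerm α h x u : ℂ)) (n : ℝ)‖ with hc
  -- Frequency `n` has `|y| = 2π|n|/h ≥ 2|n|`, so the decay `e^{-π|y|/4}` is at most `q^{|n|}`.
  set q : ℝ := Real.exp (-1.57) with hq
  have hq0 : 0 < q := Real.exp_pos _
  have hq1 : q ≤ 0.2084 := by
    rw [hq, Real.exp_neg, inv_le_comm₀ (Real.exp_pos _) (by norm_num)]
    have h1 : Real.exp 1.57 = Real.exp 1 * Real.exp 0.57 := by rw [← Real.exp_add]; norm_num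
    have h2 := Real.sum_le_exp_of_nonneg (x := 0.57) (by norm_num) 5
    simp [Finset.sum_range_succ, Nat.factorial] at h2
    have h3 := Real.exp_one_gt_d9
    rw [h1]
    nlinarith
  have hG := Real.Gamma_pos_of_pos hα
  have hxp : 0 < x ^ (-α) := Real.rpow_pos_of_pos hx _
  set C : ℝ := h⁻¹ * (x ^ (-α) * (Real.Gamma α * α * 0.854)) with hC
  have hC0 : 0 < C := by positivity
  have hcn : ∀ n : ℤ, n ≠ 0 → c n ≤ C * q ^ n.natAbs := by
    intro n hn
    have hn1 : (1 : ℝ) ≤ |(n : ℝ)| := by exact_mod_cast Int.one_le_abs hn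
    have hy : |2 * Real.pi / h * n| = 2 * Real.pi / h * |(n : ℝ)| := by
      rw [abs_mul, abs_of_pos (by linarith)]
    have hy2 : 2 * |(n : ℝ)| ≤ |2 * Real.pi / h * n| := by rw [hy]; gcongr
    simp only [hc]
    rw [norm_fourier_expTerm hα hh hx]
    have hg := norm_Gamma_le_exp hα hα1 (y := 2 * Real.pi / h * n) (by linarith)
    have he : Real.exp (-(Real.pi * |2 * Real.pi / h * n| / 4)) ≤ q ^ n.natAbs := by
      rw [hq, ← Real.exp_nat_mul, Real.exp_le_exp]
      have : ((n.natAbs : ℕ) : ℝ) = |(n : ℝ)| := by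
        rw [Nat.cast_natAbs]; push_cast; rfl
      rw [this]
      nlinarith [Real.pi_gt_d2]
    calc _ ≤ h⁻¹ * (x ^ (-α) * (Real.Gamma α * α * 0.854 * q ^ n.natAbs)) := by
          gcongr
          exact hg.trans (by gcongr)
      _ = _ := by rw [hC]; ring
  have hc0 : c 0 = h⁻¹ * (x ^ (-α) * Real.Gamma α) := by
    simp only [hc]
    rw [norm_fourier_expTerm hα hh hx]
    simp [Complex.Gamma_ofReal, abs_of_pos hG]
  have hgeo : HasSum (fun n : ℕ => C * q ^ (n + 1)) (C * (q * (1 - q)⁻¹)) := by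
    have := ((hasSum_geometric_of_lt_one hq0.le (by linarith)).mul_left q).mul_left C
    simpa [pow_succ, mul_comm, mul_left_comm] using this
  have hcpos : ∀ n : ℤ, 0 ≤ c n := fun n => norm_nonneg _
  have hp1 : ∀ n : ℕ, c ((n : ℤ) + 1) ≤ C * q ^ (n + 1) := fun n => by
    have := hcn ((n : ℤ) + 1) (by omega)
    rwa [show ((n : ℤ) + 1).natAbs = n + 1 by omega] at this
  have hp2 : ∀ n : ℕ, c (-((n : ℤ) + 1)) ≤ C * q ^ (n + 1) := fun n => by
    have := hcn (-((n : ℤ) + 1)) (by omega)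
    rwa [show (-((n : ℤ) + 1)).natAbs = n + 1 by omega] at this
  have s1 : Summable fun n : ℕ => c ((n : ℤ) + 1) :=
    Summable.of_nonneg_of_le (fun n => hcpos _) hp1 hgeo.summable
  have s2 : Summable fun n : ℕ => c (-((n : ℤ) + 1)) :=
    Summable.of_nonneg_of_le (fun n => hcpos _) hp2 hgeo.summable
  have hs : HasSum c (∑' n : ℕ, c ((n : ℤ) + 1) + c 0 + ∑' n : ℕ, c (-((n : ℤ) + 1))) :=
    HasSum.of_add_one_of_neg_add_one s1.hasSum s2.hasSum
  have hle : ∑' n, c n ≤ h⁻¹ * (x ^ (-α) * (Real.Gamma α * (1 + α / 2))) := by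
    rw [hs.tsum_eq, hc0]
    have b1 := Summable.tsum_le_tsum hp1 s1 hgeo.summable
    have b2 := Summable.tsum_le_tsum hp2 s2 hgeo.summable
    rw [hgeo.tsum_eq] at b1 b2
    have hq2 : q * (1 - q)⁻¹ ≤ 0.2084 / 0.7916 := by
      rw [← div_eq_mul_inv, div_le_div_iff₀ (by linarith) (by norm_num)]
      linarith
    have b3 : C * (q * (1 - q)⁻¹) ≤ C * (0.2084 / 0.7916) := by gcongr
    have hD : 0 < h⁻¹ * (x ^ (-α) * (Real.Gamma α * α)) := by positivity
    have e1 : C * (0.2084 / 0.7916)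
        = h⁻¹ * (x ^ (-α) * (Real.Gamma α * α)) * (0.854 * (0.2084 / 0.7916)) := by rw [hC]; ring
    -- Positive and negative frequencies contribute at most `α/4` each, relative to the zero
    -- frequency.
    have b4 : C * (0.2084 / 0.7916) ≤ h⁻¹ * (x ^ (-α) * (Real.Gamma α * α)) * (1 / 4) := by
      rw [e1]; gcongr; norm_num
    linarith
  have hsum : Summable fun n : ℤ =>
      FourierTransform.fourier (fun u : ℝ => (expTerm α h x u : ℂ)) (n : ℝ) :=
    Summable.of_norm hs.summable
  have hP := Real.tsum_eq_tsum_fourier_of_rpow_decay_of_summable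
    (f := fun u : ℝ => (expTerm α h x u : ℂ))
    (Complex.continuous_ofReal.comp (continuous_expTerm α h x)) one_lt_two
    (expTerm_isBigO hα hh hx) hsum 0
  have hnn : ∀ u, 0 ≤ expTerm α h x u := fun u => by unfold expTerm; positivity
  have hS : Summable fun n : ℤ => expTerm α h x n := by
    have := summable_of_isBigO (Real.summable_abs_int_rpow one_lt_two)
      ((expTerm_isBigO hα hh hx).comp_tendsto Int.tendsto_coe_cofinite)
    exact Complex.summable_ofReal.1 this
  have hfin : ∑' n : ℤ, expTerm α h x n ≤ ∑' n, c n := by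
    have e : ((∑' n : ℤ, expTerm α h x n : ℝ) : ℂ)
        = ∑' n : ℤ, FourierTransform.fourier (fun u : ℝ => (expTerm α h x u : ℂ)) (n : ℝ) := by
      rw [Complex.ofReal_tsum]
      simpa using hP
    have e2 := congrArg norm e
    rw [Complex.norm_real, Real.norm_eq_abs, abs_of_nonneg (tsum_nonneg fun n => hnn _)] at e2
    rw [e2]
    exact norm_tsum_le_tsum_norm hs.summable
  have hle2 : ∑ i ∈ s, expTerm α h x i ≤ ∑' n : ℤ, expTerm α h x n :=
    hS.sum_le_tsum s (fun _ _ => hnn _)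
  calc h * ∑ i ∈ s, expTerm α h x i
      ≤ h * (h⁻¹ * (x ^ (-α) * (Real.Gamma α * (1 + α / 2)))) := by
        gcongr; linarith
    _ = _ := by field_simp

end PoissonBound

end FL2

namespace FL2

/-! ### Discrete energy inequality and Grönwall argument for monotone weights. -/

section Energy

/-- Summation by parts with nondecreasing weights. -/
theorem abel_le_sum {G r : ℕ → ℝ} {m : ℕ} (hG : ∀ j < m, G j ≤ G (j + 1))
    (hr : ∀ j, 1 ≤ j → j ≤ m → 0 ≤ r j) :
    G 0 * r 0 - G m * r (m + 1) ≤ ∑ j ∈ Finset.range (m + 1), G j * (r j - r (j + 1)) := by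
  induction m with
  | zero => simp; linarith
  | succ m ih =>
    rw [Finset.sum_range_succ]
    have h1 := ih (fun j hj => hG j (by omega)) (fun j h hj => hr j h (by omega))
    have h2 := mul_le_mul_of_nonneg_right (hG m (by omega)) (hr (m + 1) (by omega) le_rfl)
    linarith

/-- For a positive semidefinite form, a discrete fractional derivative with nondecreasing weights
`G` satisfies the discrete energy inequality at the offset `σ`, once the last two weights
satisfy `σ² G_{k-1} ≤ (2σ - 1) G_k`. -/
theorem sum_sub_le_two_mul_form {V : Type*} [AddCommGroup V] [Module ℝ V]
    (B : LinearMap.BilinForm ℝ V) (hsymm : ∀ x y, B x y = B y x) (hpos : ∀ x, 0 ≤ B x x)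
    (x : ℕ → V) {G : ℕ → ℝ} {k : ℕ} {σ : ℝ} (hG0 : 0 ≤ G 0)
    (hG : ∀ j < k, G j ≤ G (j + 1)) (hσ : 0 ≤ (2 * σ - 1) * G k)
    (hlast : ∀ l, k = l + 1 → σ ^ 2 * G l ≤ (2 * σ - 1) * G k) :
    ∑ j ∈ Finset.range (k + 1), G j * (B (x (j + 1)) (x (j + 1)) - B (x j) (x j))
      ≤ 2 * B (∑ j ∈ Finset.range (k + 1), G j • (x (j + 1) - x j))
          (σ • x (k + 1) + (1 - σ) • x k) := by
  set D := x (k + 1) - x k with hD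
  set r : ℕ → ℝ := fun j => B (x k - x j + σ • D) (x k - x j + σ • D) with hr
  -- With `w = x_k + σD` and `r_j = |w - x_j|²`, polarization gives `2B(x_{j+1} - x_j, w) -
  -- |x_{j+1}|² + |x_j|² = r_j - r_{j+1}`. For `j = k` this is `(σ² - (1 - σ)²)|D|² = (2σ - 1)|D|²`.
  have hlin : 2 * B (∑ j ∈ Finset.range (k + 1), G j • (x (j + 1) - x j))
      (σ • x (k + 1) + (1 - σ) • x k)
        - ∑ j ∈ Finset.range (k + 1), G j * (B (x (j + 1)) (x (j + 1)) - B (x j) (x j))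
      = (∑ j ∈ Finset.range k, G j * (r j - r (j + 1))) + (2 * σ - 1) * G k * B D D := by
    have hw : σ • x (k + 1) + (1 - σ) • x k = x k + σ • D := by rw [hD]; module
    rw [hw, map_sum, LinearMap.sum_apply, Finset.mul_sum, ← Finset.sum_sub_distrib,
      Finset.sum_range_succ]
    congr 1
    · refine Finset.sum_congr rfl fun j _ => ?_
      simp only [hr, map_smul, map_add, map_sub, LinearMap.smul_apply, LinearMap.add_apply,
        LinearMap.sub_apply, smul_eq_mul]
      rw [hsymm (x k) (x j), hsymm (x k) (x (j + 1)), hsymm D (x j), hsymm D (x (j + 1))]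
      ring
    · have hx : x (k + 1) = x k + D := by rw [hD]; abel
      rw [hx]
      simp only [map_smul, map_add, map_sub, LinearMap.smul_apply, LinearMap.add_apply,
        LinearMap.sub_apply, smul_eq_mul]
      rw [hsymm D (x k)]
      ring
  rw [← sub_nonneg, hlin]
  cases k with
  | zero =>
    rw [Finset.sum_range_zero, zero_add]
    exact mul_nonneg hσ (hpos D)
  | succ l =>
    have h1 := abel_le_sum (G := G) (r := r) (m := l) (fun j hj => hG j (by omega))
      (fun j _ _ => hpos _)
    have h2 : r (l + 1) = σ ^ 2 * B D D := by
      simp only [hr, sub_self, zero_add, map_smul, LinearMap.smul_apply, smul_eq_mul]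
      ring
    rw [h2] at h1
    have h3 := mul_le_mul_of_nonneg_right (hlast l rfl) (hpos D)
    have h4 := mul_nonneg hG0 (hpos (x (l + 1) - x 0 + σ • D))
    simp only [hr] at h1 ⊢
    linarith

/-- Discrete fractional Grönwall inequality without growth term. -/
theorem le_add_div_of_sum_le {n : ℕ} {G : ℕ → ℕ → ℝ} {E : ℕ → ℝ} {c R : ℝ} (hc : 0 < c)
    (hR : 0 ≤ R) (hG0 : ∀ k < n, c ≤ G k 0) (hG : ∀ k < n, ∀ j < k, G k j ≤ G k (j + 1))
    (hE : ∀ k < n, ∑ j ∈ Finset.range (k + 1), G k j * (E (j + 1) - E j) ≤ R) :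
    ∀ k ≤ n, E k ≤ E 0 + R / c := by
  intro k
  induction k using Nat.strong_induction_on with
  | _ k ih =>
    intro hk
    cases k with
    | zero => exact le_add_of_nonneg_right (by positivity)
    | succ k =>
      have hkn : k < n := by omega
      have hmono : ∀ j ≤ k, c ≤ G k j := by
        intro j
        induction j with
        | zero => exact fun _ => hG0 k hkn
        | succ j ihj => exact fun hj => (ihj (by omega)).trans (hG k hkn j (by omega))
      -- Abel summation is applied to the deficits below the claimed bound, nonnegative up to `k` by
      -- induction. The initial deficit `R/c` times `G k 0 ≥ c` compensates the source `R`, so the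
      -- next deficit is nonnegative too.
      have h1 := abel_le_sum (G := G k) (r := fun j => E 0 + R / c - E j) (m := k)
        (hG k hkn) (fun j _ hj => by
          have := ih j (by omega) (by omega)
          linarith)
      have h2 : ∑ j ∈ Finset.range (k + 1),
          G k j * (E 0 + R / c - E j - (E 0 + R / c - E (j + 1)))
          = ∑ j ∈ Finset.range (k + 1), G k j * (E (j + 1) - E j) :=
        Finset.sum_congr rfl fun j _ => by ring
      simp only [h2] at h1
      have h3 := hE k hkn
      have h4 : R ≤ G k 0 * (R / c) := by
        calc R = c * (R / c) := by field_simp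
          _ ≤ _ := by gcongr; exact hG0 k hkn
      have h5 : 0 ≤ G k k * (E 0 + R / c - E (k + 1)) := by
        have : E 0 + R / c - E 0 = R / c := by ring
        rw [this] at h1
        linarith
      have h6 : 0 < G k k := hc.trans_le (hmono k le_rfl)
      have := nonneg_of_mul_nonneg_right h5 h6
      linarith

end Energy

end FL2

/-! ### The spatial operators as commuting positive semidefinite matrices on the interior points. -/

noncomputable section
namespace FL2

namespace Grid

open Matrix
open scoped MatrixOrder

variable {d : ℕ} (g : Grid d)

theorem mem_intIdx {j : Fin d → ℤ} : j ∈ g.intIdx ↔ ∀ i, 1 ≤ j i ∧ j i ≤ (g.m i : ℤ) - 1 := by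
  simp [intIdx, Fintype.mem_piFinset]

theorem mem_allIdx {j : Fin d → ℤ} : j ∈ g.allIdx ↔ ∀ i, 0 ≤ j i ∧ j i ≤ (g.m i : ℤ) := by
  simp [allIdx, Fintype.mem_piFinset]

/-- The restriction of a grid function to the interior grid points. -/
def res (v : (Fin d → ℤ) → ℝ) : g.intIdx → ℝ := fun j => v j

/-- The matrix of the translation by `a` for functions on the interior grid points. -/
def trans (a : Fin d → ℤ) : Matrix g.intIdx g.intIdx ℝ :=
  Matrix.of fun j j' => if (j' : Fin d → ℤ) = j + a then 1 else 0

theorem trans_apply (a : Fin d → ℤ) (j j' : g.intIdx) :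
    g.trans a j j' = if (j' : Fin d → ℤ) = j + a then 1 else 0 := rfl

theorem trans_transpose (a : Fin d → ℤ) : (g.trans a)ᵀ = g.trans (-a) := by
  ext j j'
  rw [transpose_apply, trans_apply, trans_apply]
  congr 1
  rw [← sub_eq_add_neg, eq_sub_iff_add_eq, eq_iff_iff, eq_comm]

theorem sum_ite_eq_shift (a : Fin d → ℤ) (j : Fin d → ℤ) (F : (Fin d → ℤ) → ℝ) :
    ∑ l : g.intIdx, (if (l : Fin d → ℤ) = j + a then F l else 0)
      = if j + a ∈ g.intIdx then F (j + a) else 0 := by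
  rw [Finset.sum_coe_sort g.intIdx (fun l => if l = j + a then F l else 0)]
  rw [Finset.sum_ite_eq' g.intIdx (j + a)]

theorem trans_mulVec_res (a : Fin d → ℤ) (v : (Fin d → ℤ) → ℝ) (j : g.intIdx) :
    (g.trans a *ᵥ g.res v) j = if (j + a : Fin d → ℤ) ∈ g.intIdx then v (j + a) else 0 := by
  rw [← g.sum_ite_eq_shift a j v]
  simp [mulVec, dotProduct, trans_apply, res]

theorem trans_mul_trans (a b : Fin d → ℤ) (j j' : g.intIdx) :
    (g.trans a * g.trans b) j j'
      = if (j + a : Fin d → ℤ) ∈ g.intIdx ∧ (j' : Fin d → ℤ) = j + a + b then 1 else 0 := by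
  have := g.sum_ite_eq_shift a j (fun l => if (j' : Fin d → ℤ) = l + b then (1 : ℝ) else 0)
  rw [mul_apply]
  simp only [trans_apply, ite_mul, one_mul, zero_mul]
  rw [this, ite_and]

/-- Each coordinate is changed by only one of the two moves, so if both ends of the path lie in the
box, either intermediate corner does as well. -/
theorem commute_trans_single {i k : Fin d} (h : i ≠ k) (a b : ℤ) :
    Commute (g.trans (Pi.single i a)) (g.trans (Pi.single k b)) := by
  ext j j'
  rw [trans_mul_trans, trans_mul_trans]
  have hj := g.mem_intIdx.1 j.2
  have hj' := g.mem_intIdx.1 j'.2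
  have key : ∀ (p q : Fin d) (x y : ℤ), p ≠ q →
      (j' : Fin d → ℤ) = (j : Fin d → ℤ) + Pi.single p x + Pi.single q y →
      ((j : Fin d → ℤ) + Pi.single p x) ∈ g.intIdx := by
    intro p q x y hpq e
    rw [mem_intIdx]
    intro r
    rcases eq_or_ne r p with rfl | hr
    · have := congrFun e r
      simp [hpq] at this
      have := hj' r
      simp
      omega
    · simpa [hr] using hj r
  congr 1
  rw [eq_iff_iff]
  constructor
  · rintro ⟨-, e⟩
    have e' : (j' : Fin d → ℤ) = (j : Fin d → ℤ) + Pi.single k b + Pi.single i a := by rw [e]; abel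
    exact ⟨key k i b a h.symm e', e'⟩
  · rintro ⟨-, e⟩
    have e' : (j' : Fin d → ℤ) = (j : Fin d → ℤ) + Pi.single i a + Pi.single k b := by rw [e]; abel
    exact ⟨key i k a b h e', e'⟩

/-- The matrix of `-(Δx^{(i)})² δ_i²` with homogeneous Dirichlet boundary values. -/
def stiff (i : Fin d) : Matrix g.intIdx g.intIdx ℝ :=
  2 - g.trans (Pi.single i 1) - g.trans (Pi.single i (-1))

theorem commute_stiff (i k : Fin d) : Commute (g.stiff i) (g.stiff k) := by
  rcases eq_or_ne i k with rfl | h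
  · exact Commute.refl _
  · have c := fun a b => g.commute_trans_single h a b
    have two : ∀ M : Matrix g.intIdx g.intIdx ℝ, Commute 2 M := fun M => Commute.ofNat_left 2 M
    unfold stiff
    refine Commute.sub_left (Commute.sub_left (two _) ?_) ?_ <;>
    exact Commute.sub_right (Commute.sub_right (two _).symm (c _ _)) (c _ _)

theorem trans_single_transpose (i : Fin d) :
    (g.trans (Pi.single i 1))ᵀ = g.trans (Pi.single i (-1)) := by
  rw [trans_transpose, Pi.single_neg]

theorem one_sub_transpose_mul_trans_posSemidef (a : Fin d → ℤ) :
    (1 - (g.trans a)ᵀ * g.trans a).PosSemidef := by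
  have : 1 - (g.trans a)ᵀ * g.trans a
      = diagonal fun j : g.intIdx => if (j - a : Fin d → ℤ) ∈ g.intIdx then (0 : ℝ) else 1 := by
    ext j j'
    rw [Matrix.sub_apply, trans_transpose, trans_mul_trans, diagonal_apply, one_apply]
    rcases eq_or_ne j j' with rfl | h
    · simp [sub_eq_add_neg]
      split_ifs <;> simp
    · have : (j' : Fin d → ℤ) ≠ j := fun e => h (Subtype.ext e.symm)
      simp [h, this]
  rw [this]
  exact PosSemidef.diagonal fun j => by dsimp; split_ifs <;> simp

/-- With `S` the unit translation, `2 - S - Sᵀ = (1 - S)ᵀ(1 - S) + (1 - SᵀS)`; the last term is a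
diagonal indicator accounting for the boundary. Replacing `1 - S` by `1 + S` gives the upper bound
4. -/
theorem stiff_nonneg (i : Fin d) : 0 ≤ g.stiff i := by
  rw [nonneg_iff_posSemidef]
  have : g.stiff i = (1 - g.trans (Pi.single i 1))ᴴ * (1 - g.trans (Pi.single i 1))
      + (1 - (g.trans (Pi.single i 1))ᵀ * g.trans (Pi.single i 1)) := by
    rw [conjTranspose_eq_transpose_of_trivial, transpose_sub, transpose_one,
      trans_single_transpose, stiff, ← one_add_one_eq_two]
    noncomm_ring
  rw [this]
  exact (posSemidef_conjTranspose_mul_self _).add (g.one_sub_transpose_mul_trans_posSemidef _)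

theorem four_sub_stiff_nonneg (i : Fin d) : 0 ≤ 4 - g.stiff i := by
  rw [nonneg_iff_posSemidef]
  have : 4 - g.stiff i = (1 + g.trans (Pi.single i 1))ᴴ * (1 + g.trans (Pi.single i 1))
      + (1 - (g.trans (Pi.single i 1))ᵀ * g.trans (Pi.single i 1)) := by
    rw [conjTranspose_eq_transpose_of_trivial, transpose_add, transpose_one,
      trans_single_transpose, stiff,
      show (4 : Matrix g.intIdx g.intIdx ℝ) = 1 + 1 + 1 + 1 by norm_num, ← one_add_one_eq_two]
    noncomm_ring
  rw [this]
  exact (posSemidef_conjTranspose_mul_self _).add (g.one_sub_transpose_mul_trans_posSemidef _)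

/-- The matrix of `𝒜_i` with homogeneous Dirichlet boundary values. -/
def avgMat (i : Fin d) : Matrix g.intIdx g.intIdx ℝ := 1 - (1 / 12 : ℝ) • g.stiff i

theorem commute_avgMat_stiff (i k : Fin d) : Commute (g.avgMat i) (g.stiff k) :=
  Commute.sub_left (Commute.one_left _) ((g.commute_stiff i k).smul_left _)

theorem commute_avgMat (i k : Fin d) : Commute (g.avgMat i) (g.avgMat k) :=
  Commute.sub_right (Commute.one_right _) ((g.commute_avgMat_stiff i k).smul_right _)

/-- `stiff i ≤ 4`, and `1 - 4/12 = 2/3`. -/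
theorem two_thirds_le_avgMat (i : Fin d) : (2 / 3 : ℝ) • 1 ≤ g.avgMat i := by
  rw [← sub_nonneg]
  have : g.avgMat i - (2 / 3 : ℝ) • 1 = (1 / 12 : ℝ) • (4 - g.stiff i) := by
    rw [avgMat, smul_sub, show (4 : Matrix g.intIdx g.intIdx ℝ) = (4 : ℝ) • 1 by
      rw [← Algebra.algebraMap_eq_smul_one, map_ofNat]]
    module
  rw [this]
  exact smul_nonneg (by norm_num) (g.four_sub_stiff_nonneg i)

/-- The product of the matrices `avgMat` along a list of directions. -/
def avgListMat (l : List (Fin d)) : Matrix g.intIdx g.intIdx ℝ := (l.map g.avgMat).prod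

theorem commute_avgMat_avgListMat (i : Fin d) (l : List (Fin d)) :
    Commute (g.avgMat i) (g.avgListMat l) := by
  refine Commute.list_prod_right _ _ fun M hM => ?_
  obtain ⟨k, -, rfl⟩ := List.mem_map.1 hM
  exact g.commute_avgMat i k

theorem commute_avgListMat_stiff (l : List (Fin d)) (k : Fin d) :
    Commute (g.avgListMat l) (g.stiff k) := by
  refine Commute.list_prod_left _ _ fun M hM => ?_
  obtain ⟨i, -, rfl⟩ := List.mem_map.1 hM
  exact g.commute_avgMat_stiff i k

theorem avgMat_nonneg (i : Fin d) : 0 ≤ g.avgMat i :=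
  (smul_nonneg (by norm_num) zero_le_one).trans (g.two_thirds_le_avgMat i)

theorem avgListMat_nonneg (l : List (Fin d)) : 0 ≤ g.avgListMat l := by
  induction l with
  | nil => exact zero_le_one
  | cons i l ih =>
    rw [avgListMat, List.map_cons, List.prod_cons]
    exact Commute.mul_nonneg (g.avgMat_nonneg i) ih (g.commute_avgMat_avgListMat i l)

/-- One factor is peeled off at a time; products of commuting positive semidefinite matrices are
positive semidefinite. Commutativity is essential here and in the comparisons below. -/
theorem two_thirds_pow_le_avgListMat (l : List (Fin d)) :
    ((2 / 3 : ℝ) ^ l.length) • 1 ≤ g.avgListMat l := by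
  induction l with
  | nil => simp [avgListMat]
  | cons i l ih =>
    rw [← sub_nonneg] at ih ⊢
    have e : g.avgListMat (i :: l) - ((2 / 3 : ℝ) ^ (i :: l).length) • 1
        = (g.avgMat i - (2 / 3 : ℝ) • 1) * g.avgListMat l
          + (2 / 3 : ℝ) • (g.avgListMat l - ((2 / 3 : ℝ) ^ l.length) • 1) := by
      rw [List.length_cons, pow_succ', mul_smul, sub_mul, smul_mul_assoc, one_mul,
        avgListMat, List.map_cons, List.prod_cons, avgListMat]
      module
    rw [e]
    refine add_nonneg (Commute.mul_nonneg (sub_nonneg.2 (g.two_thirds_le_avgMat i))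
      (g.avgListMat_nonneg l) ?_) (smul_nonneg (by norm_num) ih)
    exact (g.commute_avgMat_avgListMat i l).sub_left ((Commute.one_left _).smul_left _)

/-- The matrix of `-Δ_h` with homogeneous Dirichlet boundary values. -/
def lapMat : Matrix g.intIdx g.intIdx ℝ := ∑ i, (g.dx i ^ 2)⁻¹ • g.stiff i

/-- The matrix of `-Λ_h` with homogeneous Dirichlet boundary values. -/
def compactLapMat : Matrix g.intIdx g.intIdx ℝ :=
  ∑ i, (g.dx i ^ 2)⁻¹ • (g.avgListMat ((List.finRange d).filter fun l => l ≠ i) * g.stiff i)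

theorem lapMat_nonneg : 0 ≤ g.lapMat :=
  Finset.sum_nonneg fun i _ => smul_nonneg (by positivity) (g.stiff_nonneg i)

theorem commute_avgListMat_lapMat (l : List (Fin d)) : Commute (g.avgListMat l) g.lapMat :=
  Commute.sum_right _ _ _ fun i _ => (g.commute_avgListMat_stiff l i).smul_right _

theorem commute_stiff_lapMat (k : Fin d) : Commute (g.stiff k) g.lapMat :=
  Commute.sum_right _ _ _ fun i _ => (g.commute_stiff k i).smul_right _

theorem length_filter_ne (i : Fin d) :
    ((List.finRange d).filter fun l => l ≠ i).length = d - 1 := by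
  rw [← List.toFinset_card_of_nodup ((List.nodup_finRange d).filter _)]
  have : (((List.finRange d).filter fun l => l ≠ i)).toFinset = Finset.univ.erase i := by
    ext; simp
  rw [this, Finset.card_erase_of_mem (Finset.mem_univ i), Finset.card_univ, Fintype.card_fin]

theorem compactLapMat_sub_nonneg : 0 ≤ g.compactLapMat - ((2 / 3 : ℝ) ^ (d - 1)) • g.lapMat := by
  have e : g.compactLapMat - ((2 / 3 : ℝ) ^ (d - 1)) • g.lapMat
      = ∑ i, (g.dx i ^ 2)⁻¹ • ((g.avgListMat ((List.finRange d).filter fun l => l ≠ i)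
          - ((2 / 3 : ℝ) ^ (d - 1)) • 1) * g.stiff i) := by
    rw [compactLapMat, lapMat, Finset.smul_sum, ← Finset.sum_sub_distrib]
    refine Finset.sum_congr rfl fun i _ => ?_
    rw [sub_mul, smul_mul_assoc, one_mul]
    module
  rw [e]
  refine Finset.sum_nonneg fun i _ => smul_nonneg (by positivity) ?_
  have h := g.two_thirds_pow_le_avgListMat ((List.finRange d).filter fun l => l ≠ i)
  rw [length_filter_ne] at h
  refine Commute.mul_nonneg (sub_nonneg.2 h) (g.stiff_nonneg i) ?_
  exact (g.commute_avgListMat_stiff _ i).sub_left ((Commute.one_left _).smul_left _)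

theorem commute_compactLapMat_lapMat : Commute g.compactLapMat g.lapMat :=
  Commute.sum_left _ _ _ fun i _ =>
    ((g.commute_avgListMat_lapMat _).mul_left (g.commute_stiff_lapMat i)).smul_left _

theorem compactLapMat_mul_lapMat_le :
    ((2 / 3 : ℝ) ^ (d - 1)) • (g.lapMat * g.lapMat) ≤ g.compactLapMat * g.lapMat := by
  rw [← sub_nonneg, ← smul_mul_assoc, ← sub_mul]
  exact Commute.mul_nonneg g.compactLapMat_sub_nonneg g.lapMat_nonneg
    (g.commute_compactLapMat_lapMat.sub_left ((Commute.refl _).smul_left _))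

end Grid

end FL2

end

/-! ### From grid functions to matrices, and the energy estimate at one time level. -/

noncomputable section

namespace FL2

namespace Grid

open Matrix
open scoped MatrixOrder

variable {d : ℕ} (g : Grid d)

/-- `w` vanishes at all boundary points that are interior with respect to the directions in `s`. -/
def VanishesOn (s : Set (Fin d)) (w : (Fin d → ℤ) → ℝ) : Prop :=
  ∀ j ∈ g.bdryIdx, (∀ i ∈ s, 1 ≤ j i ∧ j i ≤ (g.m i : ℤ) - 1) → w j = 0

theorem add_single_mem_allIdx {j : Fin d → ℤ} (hj : ∀ r, 0 ≤ j r ∧ j r ≤ (g.m r : ℤ)) {i : Fin d}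
    (hi : 1 ≤ j i ∧ j i ≤ (g.m i : ℤ) - 1) {a : ℤ} (ha : a = 1 ∨ a = -1) :
    j + Pi.single i a ∈ g.allIdx := by
  rw [mem_allIdx]
  intro r
  rcases eq_or_ne r i with rfl | hr
  · simp; omega
  · simpa [hr] using hj r

/-- A step in a direction outside `s` keeps the `s`-coordinates interior, so the zero extension
built into `trans` reads the true neighbour values. -/
theorem VanishesOn.eq_ite {g : Grid d} {s : Set (Fin d)} {w : (Fin d → ℤ) → ℝ}
    (hw : g.VanishesOn s w) {i : Fin d} (hi : i ∉ s) {a : ℤ} (ha : a = 1 ∨ a = -1)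
    {j : Fin d → ℤ} (hj : j ∈ g.intIdx) :
    w (j + Pi.single i a) = if j + Pi.single i a ∈ g.intIdx then w (j + Pi.single i a) else 0 := by
  split_ifs with h
  · rfl
  rw [mem_intIdx] at hj
  refine hw _ (Finset.mem_sdiff.2 ⟨g.add_single_mem_allIdx (fun r => ?_) (hj i) ha, h⟩) ?_
  · have := hj r; omega
  · intro r hr
    have : r ≠ i := fun e => hi (e ▸ hr)
    simpa [this] using hj r

theorem stiff_mulVec_res {s : Set (Fin d)} {w : (Fin d → ℤ) → ℝ} (hw : g.VanishesOn s w)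
    {i : Fin d} (hi : i ∉ s) (j : g.intIdx) :
    (g.stiff i *ᵥ g.res w) j
      = 2 * w j - w ((j : Fin d → ℤ) + Pi.single i 1) - w ((j : Fin d → ℤ) - Pi.single i 1) := by
  have h2 : ((2 : Matrix g.intIdx g.intIdx ℝ) *ᵥ g.res w) j = 2 * w j := by
    rw [ofNat_mulVec]; rfl
  have e : (j : Fin d → ℤ) - Pi.single i 1 = (j : Fin d → ℤ) + Pi.single i (-1) := by
    rw [Pi.single_neg, sub_eq_add_neg]
  rw [stiff, sub_mulVec, sub_mulVec, Pi.sub_apply, Pi.sub_apply, trans_mulVec_res,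
    trans_mulVec_res, h2, e, ← hw.eq_ite hi (Or.inl rfl) j.2, ← hw.eq_ite hi (Or.inr rfl) j.2]

theorem res_avg {s : Set (Fin d)} {w : (Fin d → ℤ) → ℝ} (hw : g.VanishesOn s w)
    {i : Fin d} (hi : i ∉ s) : g.res (g.avg i w) = g.avgMat i *ᵥ g.res w := by
  funext j
  rw [avgMat, sub_mulVec, one_mulVec, smul_mulVec, Pi.sub_apply, Pi.smul_apply,
    g.stiff_mulVec_res hw hi, res, res, avg, if_pos j.2, smul_eq_mul]
  ring

theorem VanishesOn.avg {g : Grid d} {s : Set (Fin d)} {w : (Fin d → ℤ) → ℝ}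
    (hw : g.VanishesOn s w) (i : Fin d) : g.VanishesOn s (g.avg i w) := by
  intro j hj h
  rw [Grid.avg, if_neg (Finset.mem_sdiff.1 hj).2]
  exact hw j hj h

theorem VanishesOn.avgList {g : Grid d} {s : Set (Fin d)} {w : (Fin d → ℤ) → ℝ}
    (hw : g.VanishesOn s w) (l : List (Fin d)) : g.VanishesOn s (g.avgList l w) := by
  induction l with
  | nil => exact hw
  | cons i l ih => exact ih.avg i

theorem res_avgList {s : Set (Fin d)} {w : (Fin d → ℤ) → ℝ} (hw : g.VanishesOn s w)
    {l : List (Fin d)} (hl : ∀ i ∈ l, i ∉ s) :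
    g.res (g.avgList l w) = g.avgListMat l *ᵥ g.res w := by
  induction l with
  | nil => simp [avgListMat, avgList]
  | cons i l ih =>
    rw [avgListMat, List.map_cons, List.prod_cons, ← mulVec_mulVec, ← avgListMat,
      ← ih fun k hk => hl k (List.mem_cons_of_mem _ hk)]
    exact g.res_avg (hw.avgList l) (hl i List.mem_cons_self)

theorem res_secondDiff {v : (Fin d → ℤ) → ℝ} (hv : g.VanishesOn ∅ v) (i : Fin d) :
    g.res (g.secondDiff i v) = -((g.dx i ^ 2)⁻¹ • (g.stiff i *ᵥ g.res v)) := by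
  funext j
  rw [Pi.neg_apply, Pi.smul_apply, g.stiff_mulVec_res hv (Set.notMem_empty i), res, secondDiff,
    smul_eq_mul, div_eq_inv_mul]
  ring

/-- On faces normal to direction `i`, `δ_i² v` need not vanish. At other boundary points some
coordinate `r ≠ i` is extremal, and the whole stencil stays on that face. This is enough for `Λ_h`,
whose `i`-th term averages only in directions `l ≠ i`. -/
theorem vanishesOn_secondDiff {v : (Fin d → ℤ) → ℝ} (hv : g.VanishesOn ∅ v) (i : Fin d) :
    g.VanishesOn {i} (g.secondDiff i v) := by
  intro j hj h
  have hji := h i rfl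
  obtain ⟨hja, hjn⟩ := Finset.mem_sdiff.1 hj
  have hz : ∀ a : ℤ, a = 1 ∨ a = -1 → v (j + Pi.single i a) = 0 := by
    intro a ha
    refine hv _ (Finset.mem_sdiff.2 ⟨g.add_single_mem_allIdx (g.mem_allIdx.1 hja) hji ha, ?_⟩)
      (by simp)
    intro hmem
    refine hjn (g.mem_intIdx.2 fun r => ?_)
    rcases eq_or_ne r i with rfl | hr
    · exact hji
    · simpa [hr] using g.mem_intIdx.1 hmem r
  rw [secondDiff, hz 1 (Or.inl rfl), hv j hj (by simp),
    show j - Pi.single i 1 = j + Pi.single i (-1) by rw [Pi.single_neg, sub_eq_add_neg],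
    hz (-1) (Or.inr rfl)]
  simp

theorem res_lap {v : (Fin d → ℤ) → ℝ} (hv : g.VanishesOn ∅ v) :
    g.res (g.lap v) = -(g.lapMat *ᵥ g.res v) := by
  have : g.res (g.lap v) = ∑ i, g.res (g.secondDiff i v) := by
    funext j; simp [res, lap, Finset.sum_apply]
  rw [this, lapMat, sum_mulVec, ← Finset.sum_neg_distrib]
  exact Finset.sum_congr rfl fun i _ => by rw [g.res_secondDiff hv, smul_mulVec]

theorem res_compactLap {v : (Fin d → ℤ) → ℝ} (hv : g.VanishesOn ∅ v) :
    g.res (g.compactLap v) = -(g.compactLapMat *ᵥ g.res v) := by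
  have : g.res (g.compactLap v)
      = ∑ i, g.res (g.avgList ((List.finRange d).filter fun l => l ≠ i) (g.secondDiff i v)) := by
    funext j; simp [res, compactLap, Finset.sum_apply]
  rw [this, compactLapMat, sum_mulVec, ← Finset.sum_neg_distrib]
  refine Finset.sum_congr rfl fun i _ => ?_
  rw [g.res_avgList (g.vanishesOn_secondDiff hv i) (by simp), g.res_secondDiff hv, mulVec_neg,
    mulVec_smul, smul_mulVec, mulVec_mulVec]

theorem ip_eq_dotProduct (v w : (Fin d → ℤ) → ℝ) :
    g.ip v w = (∏ r, g.dx r) * (g.res v ⬝ᵥ g.res w) := by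
  rw [ip, dotProduct, ← Finset.sum_coe_sort g.intIdx]
  rfl

/-- The Gram matrix of the inner product `⟨·, ·⟩_{𝒜_h}` on the interior grid points. -/
def gram : Matrix g.intIdx g.intIdx ℝ :=
  (∏ r, g.dx r) • (g.avgListMat (List.finRange d) * g.lapMat)

variable {g}

theorem dx_pos (hbox : ∀ i, g.aL i < g.aR i) (hm : ∀ i, 0 < g.m i) (i : Fin d) : 0 < g.dx i :=
  div_pos (sub_pos.2 (hbox i)) (by exact_mod_cast hm i)

theorem gram_posSemidef (hdx : ∀ i, 0 < g.dx i) : g.gram.PosSemidef := by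
  rw [← nonneg_iff_posSemidef]
  exact smul_nonneg (Finset.prod_nonneg fun i _ => (hdx i).le)
    (Commute.mul_nonneg (g.avgListMat_nonneg _) g.lapMat_nonneg (g.commute_avgListMat_lapMat _))

theorem transpose_eq_of_nonneg {n : Type*} [Fintype n] {M : Matrix n n ℝ} (hM : 0 ≤ M) :
    Mᵀ = M := by
  rw [← conjTranspose_eq_transpose_of_trivial]
  exact (nonneg_iff_posSemidef.1 hM).1

theorem mulVec_dotProduct_mulVec {n : Type*} [Fintype n] {M : Matrix n n ℝ} (hM : 0 ≤ M)
    (N : Matrix n n ℝ) (x y : n → ℝ) : (M *ᵥ x) ⬝ᵥ (N *ᵥ y) = x ⬝ᵥ ((M * N) *ᵥ y) := by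
  rw [← mulVec_mulVec, dotProduct_mulVec x M, ← mulVec_transpose, transpose_eq_of_nonneg hM]

theorem res_neg_lap {v : (Fin d → ℤ) → ℝ} (hv : g.VanishesOn ∅ v) :
    g.res (fun j => -g.lap v j) = g.lapMat *ᵥ g.res v := by
  rw [← neg_neg (g.lapMat *ᵥ g.res v), ← g.res_lap hv]
  rfl

theorem ipA_eq {v w : (Fin d → ℤ) → ℝ} (hv : g.VanishesOn ∅ v) (hw : g.VanishesOn ∅ w) :
    g.ipA v w = g.res v ⬝ᵥ (g.gram *ᵥ g.res w) := by
  rw [ipA, ip_eq_dotProduct, avgAll, g.res_avgList hv (by simp), res_neg_lap hw,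
    mulVec_dotProduct_mulVec (g.avgListMat_nonneg _), gram, smul_mulVec, dotProduct_smul,
    smul_eq_mul]

theorem compactLapMat_nonneg : 0 ≤ g.compactLapMat :=
  (smul_nonneg (by positivity) g.lapMat_nonneg).trans (sub_nonneg.1 g.compactLapMat_sub_nonneg)

theorem ip_self_nonneg (hdx : ∀ i, 0 < g.dx i) (v : (Fin d → ℤ) → ℝ) : 0 ≤ g.ip v v :=
  mul_nonneg (Finset.prod_nonneg fun i _ => (hdx i).le)
    (Finset.sum_nonneg fun _ _ => mul_self_nonneg _)

/-- The energy estimate for one time level of the compact scheme. -/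
theorem ipA_le_of_compact_eq (hdx : ∀ i, 0 < g.dx i) {D w F : (Fin d → ℤ) → ℝ}
    (hw : g.VanishesOn ∅ w)
    (heq : ∀ j ∈ g.intIdx, g.avgAll D j = g.compactLap w j + F j) :
    g.ipA D w ≤ 1 / 4 * (3 / 2 : ℝ) ^ (d - 1) * g.ip F F := by
  set y : g.intIdx → ℝ := g.lapMat *ᵥ g.res w with hy
  have hres : g.res (g.avgAll D) = g.res F - g.compactLapMat *ᵥ g.res w := by
    have := g.res_compactLap hw
    rw [sub_eq_add_neg, ← this]
    funext j
    rw [Pi.add_apply, add_comm]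
    exact heq j j.2
  have hc : 0 ≤ ∏ r, g.dx r := Finset.prod_nonneg fun i _ => (hdx i).le
  set q : ℝ := (2 / 3) ^ (d - 1) with hq
  have hq0 : 0 < q := by positivity
  have hqi : (3 / 2 : ℝ) ^ (d - 1) = q⁻¹ := by rw [hq, ← inv_pow]; norm_num
  have hell : q * (y ⬝ᵥ y) ≤ (g.compactLapMat *ᵥ g.res w) ⬝ᵥ y := by
    rw [hy, mulVec_dotProduct_mulVec g.lapMat_nonneg, mulVec_dotProduct_mulVec compactLapMat_nonneg]
    have h := (nonneg_iff_posSemidef.1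
      (sub_nonneg.2 g.compactLapMat_mul_lapMat_le)).dotProduct_mulVec_nonneg (g.res w)
    rw [star_trivial, sub_mulVec, smul_mulVec, dotProduct_sub, dotProduct_smul, smul_eq_mul] at h
    linarith
  rw [ipA, ip_eq_dotProduct, ip_eq_dotProduct, res_neg_lap hw, hres, ← hy, hqi, sub_dotProduct]
  -- The Young weight is chosen so that `q |y|²` is exactly what `hell` absorbs.
  have hyoung : g.res F ⬝ᵥ y ≤ 1 / 4 * q⁻¹ * (g.res F ⬝ᵥ g.res F) + q * (y ⬝ᵥ y) := by
    rw [dotProduct, dotProduct, dotProduct, Finset.mul_sum, Finset.mul_sum,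
      ← Finset.sum_add_distrib]
    refine Finset.sum_le_sum fun j _ => ?_
    have : 1 / 4 * q⁻¹ * (g.res F j * g.res F j) + q * (y j * y j) - g.res F j * y j
        = (g.res F j - 2 * q * y j) ^ 2 / (4 * q) := by
      field_simp; ring
    have h2 : 0 ≤ (g.res F j - 2 * q * y j) ^ 2 / (4 * q) := by positivity
    linarith
  calc (∏ r, g.dx r) * (g.res F ⬝ᵥ y - (g.compactLapMat *ᵥ g.res w) ⬝ᵥ y)
      ≤ (∏ r, g.dx r) * (1 / 4 * q⁻¹ * (g.res F ⬝ᵥ g.res F)) := by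
        gcongr; linarith
    _ = _ := by ring

end Grid

end FL2

end

/-! ### Weights of the fast derivative: moments, monotonicity and the last-weight condition. -/

noncomputable section

namespace FL2

section Moments

/-- `∫₀¹ (3/2 - τ) e^{μ τ} dτ`. -/
def momA (μ : ℝ) : ℝ := ∫ τ in (0 : ℝ)..1, (3 / 2 - τ) * Real.exp (μ * τ)

/-- `∫₀¹ (τ - 1/2) e^{μ τ} dτ`. -/
def momB (μ : ℝ) : ℝ := ∫ τ in (0 : ℝ)..1, (τ - 1 / 2) * Real.exp (μ * τ)

/-- The density `3/2 - τ` is positive with unit mass. -/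
theorem one_le_momA {μ : ℝ} (hμ : 0 ≤ μ) : 1 ≤ momA μ := by
  have h1 : ∫ τ in (0 : ℝ)..1, (3 / 2 - τ) = 1 := by
    rw [intervalIntegral.integral_sub (by simp) (by simp), integral_id]; norm_num
  rw [← h1, momA]
  refine intervalIntegral.integral_mono_on zero_le_one
    (Continuous.intervalIntegrable (by fun_prop) _ _)
    (Continuous.intervalIntegrable (by fun_prop) _ _) fun τ hτ => ?_
  have := Real.one_le_exp (mul_nonneg hμ hτ.1)
  nlinarith [hτ.2]

/-- The density `τ - 1/2` has mean zero and changes sign at the midpoint, while `e^{μτ}` increases;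
compare with its value there. -/
theorem momB_nonneg {μ : ℝ} (hμ : 0 ≤ μ) : 0 ≤ momB μ := by
  have h1 : ∫ τ in (0 : ℝ)..1, (τ - 1 / 2) * Real.exp (μ / 2) = 0 := by
    rw [intervalIntegral.integral_mul_const,
      intervalIntegral.integral_sub (by simp) (by simp), integral_id]; norm_num
  rw [← h1, momB]
  refine intervalIntegral.integral_mono_on zero_le_one
    (Continuous.intervalIntegrable (by fun_prop) _ _)
    (Continuous.intervalIntegrable (by fun_prop) _ _) fun τ _ => ?_
  rcases le_total (1 / 2) τ with h | h
  · have : Real.exp (μ / 2) ≤ Real.exp (μ * τ) := Real.exp_le_exp.2 (by nlinarith)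
    nlinarith
  · have : Real.exp (μ * τ) ≤ Real.exp (μ / 2) := Real.exp_le_exp.2 (by nlinarith)
    nlinarith

/-- For `q ≤ p` the combined density is nonnegative with mass `p`. The factor `e^μ` later shortens
the lag from `1 + σ` to `σ` steps. -/
theorem combo_mom_le {μ p q : ℝ} (hμ : 0 ≤ μ) (hq : 0 ≤ q) (hqp : q ≤ p) :
    p * momA μ + q * momB μ ≤ p * Real.exp μ := by
  have h1 : ∫ τ in (0 : ℝ)..1, (p * (3 / 2 - τ) + q * (τ - 1 / 2)) * Real.exp μ
      = p * Real.exp μ := by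
    rw [intervalIntegral.integral_mul_const,
      intervalIntegral.integral_add (Continuous.intervalIntegrable (by fun_prop) _ _)
        (Continuous.intervalIntegrable (by fun_prop) _ _),
      intervalIntegral.integral_const_mul, intervalIntegral.integral_const_mul,
      intervalIntegral.integral_sub (by simp) (by simp),
      intervalIntegral.integral_sub (by simp) (by simp), integral_id]
    norm_num
  have h2 : p * momA μ + q * momB μ
      = ∫ τ in (0 : ℝ)..1, (p * (3 / 2 - τ) + q * (τ - 1 / 2)) * Real.exp (μ * τ) := by
    rw [momA, momB, ← intervalIntegral.integral_const_mul, ← intervalIntegral.integral_const_mul,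
      ← intervalIntegral.integral_add (Continuous.intervalIntegrable (by fun_prop) _ _)
        (Continuous.intervalIntegrable (by fun_prop) _ _)]
    congr 1
    funext τ
    ring
  rw [← h1, h2]
  refine intervalIntegral.integral_mono_on zero_le_one
    (Continuous.intervalIntegrable (by fun_prop) _ _)
    (Continuous.intervalIntegrable (by fun_prop) _ _) fun τ hτ => ?_
  have : Real.exp (μ * τ) ≤ Real.exp μ := Real.exp_le_exp.2 (by nlinarith [hτ.2])
  have : 0 ≤ p * (3 / 2 - τ) + q * (τ - 1 / 2) := by
    nlinarith [hτ.1, hτ.2, mul_nonneg hq hτ.1, mul_nonneg (hq.trans hqp) (sub_nonneg.2 hτ.2)]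
  gcongr

end Moments

namespace TimeData

variable (P : TimeData)

/-- The decay rate `μ_i = λ_i Δt / T` per time step. -/
def rate (i : ℤ) : ℝ := P.lam i * P.dt / P.T

theorem coefA_eq (k : ℕ) (i : ℤ) :
    P.coefA k i = Real.exp (-(P.rate i * (P.σ k + 1))) * momA (P.rate i) := by
  rw [coefA, momA, ← intervalIntegral.integral_const_mul]
  congr 1
  funext τ
  rw [mul_left_comm, ← Real.exp_add, rate]
  ring_nf

theorem coefB_eq (k : ℕ) (i : ℤ) :
    P.coefB k i = Real.exp (-(P.rate i * (P.σ k + 1))) * momB (P.rate i) := by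
  rw [coefB, momB, ← intervalIntegral.integral_const_mul]
  congr 1
  funext τ
  rw [mul_left_comm, ← Real.exp_add, rate]
  ring_nf

/-- The recursion factor turns the lag `k - l + σ_k` into `k + 1 - l + σ_{k+1}`, so cell `l` always
carries its exact current lag. -/
theorem hist_eq_sum (v : ℕ → ℝ) (i : ℤ) (k : ℕ) :
    P.hist v i k = ∑ l ∈ Finset.range k, Real.exp (-(P.rate i * (k - l + P.σ k)))
      * (momA (P.rate i) * (v (l + 1) - v l) + momB (P.rate i) * (v (l + 2) - v (l + 1))) := by
  induction k with
  | zero => simp [hist]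
  | succ k ih =>
    rw [hist, ih, Finset.sum_range_succ, Finset.mul_sum, add_assoc]
    congr 1
    · refine Finset.sum_congr rfl fun l _ => ?_
      rw [← mul_assoc, ← Real.exp_add, rate]
      push_cast
      ring_nf
    · rw [coefA_eq, coefB_eq]
      have : ((k + 1 : ℕ) : ℝ) - k + P.σ (k + 1) = P.σ (k + 1) + 1 := by push_cast; ring
      rw [this]
      ring

/-- The prefactor `T^{-α} / Γ(1 - α)` of the history part. -/
def pref (k : ℕ) : ℝ := P.T ^ (-P.ασ k) / Real.Gamma (1 - P.ασ k)

/-- The weight of `v^{l+1} - v^l` in the linear parts of the history. -/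
def histA (k l : ℕ) : ℝ := P.pref k * ∑ i ∈ Finset.Ioc P.Nlo P.Nhi,
  P.θ k i * (Real.exp (-(P.rate i * (k - l + P.σ k))) * momA (P.rate i))

/-- The weight of `v^{l+2} - v^{l+1}` in the quadratic corrections of the history. -/
def histB (k l : ℕ) : ℝ := P.pref k * ∑ i ∈ Finset.Ioc P.Nlo P.Nhi,
  P.θ k i * (Real.exp (-(P.rate i * (k - l + P.σ k))) * momB (P.rate i))

/-- The weight of the local part. -/
def localWeight (k : ℕ) : ℝ := P.s k * P.σ k ^ (1 - P.ασ k)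

/-- The weights of the fast discrete fractional derivative. -/
def weight (k j : ℕ) : ℝ :=
  (if j < k then P.histA k j else P.localWeight k)
    + (match j with
      | 0 => 0
      | l + 1 => P.histB k l)

/-- The quadratic correction of cell `l` multiplies the following difference, hence the index shift
in `weight`. -/
theorem fastDeriv_eq_sum (v : ℕ → ℝ) (k : ℕ) :
    P.fastDeriv v k = ∑ j ∈ Finset.range (k + 1), P.weight k j * (v (j + 1) - v j) := by
  have h1 : P.pref k * ∑ i ∈ Finset.Ioc P.Nlo P.Nhi, P.θ k i * P.hist v i k
      = ∑ l ∈ Finset.range k, P.histA k l * (v (l + 1) - v l)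
        + ∑ l ∈ Finset.range k, P.histB k l * (v (l + 2) - v (l + 1)) := by
    simp only [histA, histB, hist_eq_sum, Finset.mul_sum, Finset.sum_mul]
    rw [Finset.sum_comm, ← Finset.sum_add_distrib]
    refine Finset.sum_congr rfl fun l _ => ?_
    rw [← Finset.sum_add_distrib]
    exact Finset.sum_congr rfl fun i _ => by ring
  have h2 : ∑ j ∈ Finset.range (k + 1), P.weight k j * (v (j + 1) - v j)
      = ∑ j ∈ Finset.range (k + 1),
          (if j < k then P.histA k j else P.localWeight k) * (v (j + 1) - v j)
        + ∑ l ∈ Finset.range k, P.histB k l * (v (l + 2) - v (l + 1)) := by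
    simp only [weight, add_mul, Finset.sum_add_distrib]
    congr 1
    rw [Finset.sum_range_succ']
    simp
  rw [fastDeriv, ← pref, h1, h2, Finset.sum_range_succ, if_neg (lt_irrefl k), ← localWeight]
  have h3 : ∑ j ∈ Finset.range k,
      (if j < k then P.histA k j else P.localWeight k) * (v (j + 1) - v j)
      = ∑ j ∈ Finset.range k, P.histA k j * (v (j + 1) - v j) :=
    Finset.sum_congr rfl fun j hj => by rw [if_pos (Finset.mem_range.1 hj)]
  rw [h3]
  ring

/-- The exponential sum at the time lag `x Δt`. -/
def expSum (k : ℕ) (x : ℝ) : ℝ :=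
  ∑ i ∈ Finset.Ioc P.Nlo P.Nhi, P.θ k i * Real.exp (-(P.rate i * x))

variable {P}

theorem dt_pos (hT : 0 < P.T) (hn : 0 < P.n) : 0 < P.dt := div_pos hT (by exact_mod_cast hn)

theorem rate_pos (hT : 0 < P.T) (hn : 0 < P.n) (i : ℤ) : 0 < P.rate i :=
  div_pos (mul_pos (Real.exp_pos _) (dt_pos hT hn)) hT

theorem θ_pos (hh : 0 < P.h) {k : ℕ} (hα : 0 < P.ασ k) (i : ℤ) : 0 < P.θ k i :=
  div_pos (mul_pos hh (Real.exp_pos _)) (Real.Gamma_pos_of_pos hα)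

theorem pref_pos (hT : 0 < P.T) {k : ℕ} (hα : P.ασ k < 1) : 0 < P.pref k :=
  div_pos (Real.rpow_pos_of_pos hT _) (Real.Gamma_pos_of_pos (by linarith))

theorem expSum_le (hT : 0 < P.T) (hn : 0 < P.n) (hh : 0 < P.h) (hY : 2 ≤ 2 * Real.pi / P.h)
    {k : ℕ} (hα : 0 < P.ασ k) (hα1 : P.ασ k < 1) {x : ℝ} (hx : 0 < x) :
    P.expSum k x ≤ (1 + P.ασ k / 2) * (P.dt / P.T * x) ^ (-P.ασ k) := by
  have hy : 0 < P.dt / P.T * x := mul_pos (div_pos (dt_pos hT hn) hT) hx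
  have h1 := sum_expTerm_le hα hα1 hh hy hY
    -- `expTerm` was set up with the opposite sign of the index.
    ((Finset.Ioc P.Nlo P.Nhi).map (Equiv.neg ℤ).toEmbedding)
  rw [Finset.sum_map] at h1
  have hG := Real.Gamma_pos_of_pos hα
  have h2 : P.expSum k x = (P.h * ∑ i ∈ Finset.Ioc P.Nlo P.Nhi,
      expTerm (P.ασ k) P.h (P.dt / P.T * x) (((Equiv.neg ℤ).toEmbedding i : ℤ) : ℝ))
        / Real.Gamma (P.ασ k) := by
    rw [expSum, Finset.mul_sum, Finset.sum_div]
    refine Finset.sum_congr rfl fun i _ => ?_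
    rw [expTerm, θ, rate, lam]
    simp only [Equiv.coe_toEmbedding, Equiv.neg_apply, Int.cast_neg]
    rw [show -(P.ασ k * P.h) * -(i : ℝ) = P.ασ k * i * P.h by ring,
      show -(P.h * -(i : ℝ)) = i * P.h by ring,
      show -(Real.exp (i * P.h) * P.dt / P.T * x) = -(P.dt / P.T * x) * Real.exp (i * P.h) by ring]
    ring
  rw [h2, div_le_iff₀ hG]
  refine h1.trans (le_of_eq ?_)
  ring

theorem histB_nonneg (hT : 0 < P.T) (hn : 0 < P.n) (hh : 0 < P.h) {k : ℕ} (hα : 0 < P.ασ k)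
    (hα1 : P.ασ k < 1) (l : ℕ) : 0 ≤ P.histB k l :=
  mul_nonneg (pref_pos hT hα1).le (Finset.sum_nonneg fun i _ => mul_nonneg (θ_pos hh hα i).le
    (mul_nonneg (Real.exp_pos _).le (momB_nonneg (rate_pos hT hn i).le)))

theorem histB_le_succ (hT : 0 < P.T) (hn : 0 < P.n) (hh : 0 < P.h) {k : ℕ} (hα : 0 < P.ασ k)
    (hα1 : P.ασ k < 1) (l : ℕ) : P.histB k l ≤ P.histB k (l + 1) := by
  refine mul_le_mul_of_nonneg_left (Finset.sum_le_sum fun i _ => ?_) (pref_pos hT hα1).le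
  have := rate_pos hT hn i
  have := momB_nonneg this.le
  have := θ_pos hh hα i
  gcongr
  omega

theorem histA_le_succ (hT : 0 < P.T) (hn : 0 < P.n) (hh : 0 < P.h) {k : ℕ} (hα : 0 < P.ασ k)
    (hα1 : P.ασ k < 1) (l : ℕ) : P.histA k l ≤ P.histA k (l + 1) := by
  refine mul_le_mul_of_nonneg_left (Finset.sum_le_sum fun i _ => ?_) (pref_pos hT hα1).le
  have := rate_pos hT hn i
  have := zero_le_one.trans (one_le_momA this.le)
  have := θ_pos hh hα i
  gcongr
  omega

theorem pref_mul_expSum_le_histA (hT : 0 < P.T) (hn : 0 < P.n) (hh : 0 < P.h) {k : ℕ}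
    (hα : 0 < P.ασ k) (hα1 : P.ασ k < 1) (l : ℕ) :
    P.pref k * P.expSum k (k - l + P.σ k) ≤ P.histA k l := by
  refine mul_le_mul_of_nonneg_left (Finset.sum_le_sum fun i _ => ?_) (pref_pos hT hα1).le
  have h1 := one_le_momA (rate_pos hT hn i).le
  have h2 := θ_pos hh hα i
  have h3 := Real.exp_pos (-(P.rate i * (k - l + P.σ k)))
  gcongr
  nlinarith

theorem pref_mul_dt_div (hT : 0 < P.T) (hn : 0 < P.n) (k : ℕ) {x : ℝ} (hx : 0 ≤ x) :
    P.pref k * (P.dt / P.T * x) ^ (-P.ασ k)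
      = (P.dt * x) ^ (-P.ασ k) / Real.Gamma (1 - P.ασ k) := by
  have hdt := dt_pos hT hn
  rw [pref, div_mul_eq_mul_div, ← Real.mul_rpow hT.le (by positivity)]
  congr 2
  field_simp

theorem localWeight_eq (hT : 0 < P.T) (hn : 0 < P.n) {k : ℕ} (hα1 : P.ασ k < 1)
    (hσ : 0 < P.σ k) :
    (1 - P.ασ k) * P.localWeight k
      = P.σ k * ((P.dt * P.σ k) ^ (-P.ασ k) / Real.Gamma (1 - P.ασ k)) := by
  have h1 : (1 : ℝ) - P.ασ k ≠ 0 := by linarith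
  have hG := (Real.Gamma_pos_of_pos (show 0 < 1 - P.ασ k by linarith)).ne'
  have h2 : Real.Gamma (2 - P.ασ k) = (1 - P.ασ k) * Real.Gamma (1 - P.ασ k) := by
    rw [← Real.Gamma_add_one h1]; congr 1; ring
  have h3 : P.σ k ^ (1 - P.ασ k) = P.σ k * P.σ k ^ (-P.ασ k) := by
    rw [sub_eq_add_neg, Real.rpow_add hσ, Real.rpow_one]
  rw [localWeight, s, h2, h3, Real.mul_rpow (dt_pos hT hn).le hσ.le]
  field_simp

/-- The last two weights satisfy the condition of the discrete energy inequality, up to the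
quadratic corrections. The relative error `α / 2` of `expSum_le` is small enough for this, so that
no further restriction on the tolerance is needed. -/
theorem histA_last_le (hT : 0 < P.T) (hn : 0 < P.n) (hh : 0 < P.h)
    (hY : 2 ≤ 2 * Real.pi / P.h) {k : ℕ} (hα : 0 < P.ασ (k + 1)) (hα1 : P.ασ (k + 1) < 1)
    (hσ : P.σ (k + 1) = 1 - P.ασ (k + 1) / 2) :
    P.σ (k + 1) ^ 2 * P.histA (k + 1) k + P.ασ (k + 1) ^ 2 / 4 * P.histB (k + 1) k
      ≤ (1 - P.ασ (k + 1)) * P.localWeight (k + 1) := by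
  have hσ0 : 0 < P.σ (k + 1) := by linarith
  have hlag : ((k + 1 : ℕ) : ℝ) - k + P.σ (k + 1) = P.σ (k + 1) + 1 := by push_cast; ring
  have hp := pref_pos hT hα1
  have h1 : P.σ (k + 1) ^ 2 * P.histA (k + 1) k + P.ασ (k + 1) ^ 2 / 4 * P.histB (k + 1) k
      ≤ P.pref (k + 1) * (P.σ (k + 1) ^ 2 * P.expSum (k + 1) (P.σ (k + 1))) := by
    rw [histA, histB, hlag, mul_left_comm, mul_left_comm (P.ασ (k + 1) ^ 2 / 4), ← mul_add]
    refine mul_le_mul_of_nonneg_left ?_ hp.le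
    rw [expSum, Finset.mul_sum, Finset.mul_sum, Finset.mul_sum, ← Finset.sum_add_distrib]
    refine Finset.sum_le_sum fun i _ => ?_
    -- `q = α²/4 = (1 - σ)² = σ² - (2σ - 1)`, and `q ≤ p` because `σ ≥ 1/2`.
    have hc := combo_mom_le (rate_pos hT hn i).le (p := P.σ (k + 1) ^ 2)
      (q := P.ασ (k + 1) ^ 2 / 4) (by positivity) (by rw [hσ]; nlinarith)
    have ht := (θ_pos hh hα i).le
    have he : Real.exp (-(P.rate i * P.σ (k + 1)))
        = Real.exp (-(P.rate i * (P.σ (k + 1) + 1))) * Real.exp (P.rate i) := by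
      rw [← Real.exp_add]; ring_nf
    rw [he]
    have := mul_le_mul_of_nonneg_left hc
      (mul_nonneg ht (Real.exp_pos (-(P.rate i * (P.σ (k + 1) + 1)))).le)
    linarith
  refine h1.trans ?_
  have h2 := expSum_le hT hn hh hY hα hα1 hσ0
  have h3 := pref_mul_dt_div hT hn (k + 1) hσ0.le
  rw [localWeight_eq hT hn hα1 hσ0, ← h3]
  have hz : 0 < (P.dt / P.T * P.σ (k + 1)) ^ (-P.ασ (k + 1)) :=
    Real.rpow_pos_of_pos (mul_pos (div_pos (dt_pos hT hn) hT) hσ0) _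
  have h4 : P.σ (k + 1) * (1 + P.ασ (k + 1) / 2) ≤ 1 := by rw [hσ]; nlinarith
  calc P.pref (k + 1) * (P.σ (k + 1) ^ 2 * P.expSum (k + 1) (P.σ (k + 1)))
      ≤ P.pref (k + 1) * (P.σ (k + 1) ^ 2 * ((1 + P.ασ (k + 1) / 2)
          * (P.dt / P.T * P.σ (k + 1)) ^ (-P.ασ (k + 1)))) := by gcongr
    _ = P.σ (k + 1) * (P.σ (k + 1) * (1 + P.ασ (k + 1) / 2))
          * (P.pref (k + 1) * (P.dt / P.T * P.σ (k + 1)) ^ (-P.ασ (k + 1))) := by ring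
    _ ≤ P.σ (k + 1) * 1
          * (P.pref (k + 1) * (P.dt / P.T * P.σ (k + 1)) ^ (-P.ασ (k + 1))) := by gcongr
    _ = _ := by ring

end TimeData

end FL2

end

/-! ### Quadrature step, finiteness of `c₁`, and the three weight conditions. -/

noncomputable section

namespace FL2

/-- `2π/h` is the denominator of `quadStep`, where `log 3` and `log ε⁻¹` are each at least 1. -/
theorem two_le_two_pi_div_quadStep {αmax ε : ℝ} (hα : 0 ≤ αmax) (hε0 : 0 < ε)
    (hε1 : ε ≤ 1 / Real.exp 1) :
    0 < quadStep αmax ε ∧ 2 ≤ 2 * Real.pi / quadStep αmax ε := by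
  have h1 : 1 ≤ Real.log 3 := by
    rw [Real.le_log_iff_exp_le (by norm_num)]
    linarith [Real.exp_one_lt_d9]
  have h2 : 0 ≤ Real.log (Real.cos 1)⁻¹ :=
    Real.log_nonneg ((one_le_inv₀ Real.cos_one_pos).2 (Real.cos_le_one 1))
  have h3 : 1 ≤ Real.log ε⁻¹ := by
    rw [Real.le_log_iff_exp_le (inv_pos.2 hε0), le_inv_comm₀ (Real.exp_pos 1) hε0, ← one_div]
    exact hε1
  have h4 := mul_nonneg hα h2
  have hpi := Real.pi_pos
  unfold quadStep
  have hY : 2 ≤ Real.log 3 + αmax * Real.log (Real.cos 1)⁻¹ + Real.log ε⁻¹ := by linarith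
  refine ⟨by positivity, ?_⟩
  rwa [div_div_cancel₀ (by positivity)]

namespace TimeData

variable {P : TimeData}

/-- Needed for `c₁` to dominate its values, as `α` need not be continuous. Convexity of `Γ` on `[1,
2]` gives `Γ(2 - α) ≤ 1`, so `Γ(1 - α) ≤ 1/(1 - α)`. -/
theorem bddAbove_rpow_mul_Gamma (hT : 1 ≤ P.T) {αmin αmax : ℝ} (hαmin : 0 < αmin)
    (hαmax : αmax < 1) (hα : ∀ t ∈ Set.Icc 0 P.T, P.α t ∈ Set.Icc αmin αmax) :
    BddAbove ((fun t : ℝ => t ^ P.α t * Real.Gamma (1 - P.α t)) '' Set.Icc 0 P.T) := by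
  refine ⟨P.T * (1 / (1 - αmax)), ?_⟩
  rintro _ ⟨t, ht, rfl⟩
  obtain ⟨h1, h2⟩ := hα t ht
  have hpos : 0 < 1 - P.α t := by linarith
  have hconv := Real.convexOn_Gamma.2 (Set.mem_Ioi.2 one_pos) (Set.mem_Ioi.2 two_pos)
    (show 0 ≤ P.α t by linarith) hpos.le (by ring)
  rw [Real.Gamma_one, Real.Gamma_two] at hconv
  simp only [smul_eq_mul] at hconv
  rw [show P.α t * 1 + (1 - P.α t) * 2 = 1 - P.α t + 1 by ring, Real.Gamma_add_one hpos.ne']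
    at hconv
  have hG : Real.Gamma (1 - P.α t) ≤ 1 / (1 - αmax) := by
    rw [le_div_iff₀ (by linarith)]
    nlinarith [Real.Gamma_pos_of_pos hpos]
  have hp : t ^ P.α t ≤ P.T := by
    calc t ^ P.α t ≤ P.T ^ P.α t := Real.rpow_le_rpow ht.1 ht.2 (by linarith)
      _ ≤ P.T ^ (1 : ℝ) := Real.rpow_le_rpow_of_exponent_le hT (by linarith)
      _ = P.T := Real.rpow_one _
  exact mul_le_mul hp hG (Real.Gamma_pos_of_pos hpos).le (by linarith)

theorem tσ_eq (k : ℕ) : P.tσ k = P.dt * (k + P.σ k) := by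
  rw [tσ, t]; ring

theorem tσ_mem_Ioc (hT : 0 < P.T) {k : ℕ} (hk : k < P.n) (h0 : 0 < P.σ k) (h1 : P.σ k < 1) :
    P.tσ k ∈ Set.Ioc 0 P.T := by
  have hn : 0 < P.n := by omega
  have hdt := dt_pos hT hn
  rw [tσ_eq]
  refine ⟨by positivity, ?_⟩
  have h2 : (k : ℝ) + 1 ≤ P.n := by exact_mod_cast hk
  have h3 : P.dt * P.n = P.T := by rw [dt]; field_simp
  rw [← h3]
  gcongr
  linarith

/-- For `k ≥ 1` this is the accuracy assumption at `τ = 0`, as `momA ≥ 1`. For `k = 0` only the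
local weight is present, and `σ ≥ 1 - α` suffices. -/
theorem weight_zero_ge (hT : 0 < P.T) (hh : 0 < P.h) {ε : ℝ} (hε : 0 ≤ ε)
    (hacc : P.HasAccuracy ε) {k : ℕ} (hk : k < P.n) (hα : 0 < P.ασ k) (hα1 : P.ασ k < 1)
    (hσ : P.σ k = 1 - P.ασ k / 2) :
    (1 - ε) * (P.tσ k ^ (-P.ασ k) / Real.Gamma (1 - P.ασ k)) ≤ P.weight k 0 := by
  have hn : 0 < P.n := by omega
  have hσ0 : 0 < P.σ k := by linarith
  have ht := (tσ_mem_Ioc hT hk hσ0 (by linarith)).1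
  have hX : 0 < P.tσ k ^ (-P.ασ k) / Real.Gamma (1 - P.ασ k) :=
    div_pos (Real.rpow_pos_of_pos ht _) (Real.Gamma_pos_of_pos (by linarith))
  rcases Nat.eq_zero_or_pos k with rfl | hk0
  · have h1 := localWeight_eq hT hn hα1 hσ0
    have h2 : P.tσ 0 = P.dt * P.σ 0 := by rw [tσ_eq]; simp
    rw [h2] at hX ⊢
    have h3 : P.weight 0 0 = P.localWeight 0 := by simp [weight]
    rw [h3]
    set X := (P.dt * P.σ 0) ^ (-P.ασ 0) / Real.Gamma (1 - P.ασ 0)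
    have h4 : (1 - P.ασ 0) * X ≤ (1 - P.ασ 0) * P.localWeight 0 := by
      rw [h1]
      exact mul_le_mul_of_nonneg_right (by linarith) hX.le
    have h5 := le_of_mul_le_mul_left h4 (by linarith)
    nlinarith
  · have h1 : P.weight k 0 = P.histA k 0 := by simp [weight, hk0]
    have h2 := pref_mul_expSum_le_histA hT hn hh hα hα1 0
    have h3 := pref_mul_dt_div hT hn k (x := k + P.σ k) (by positivity)
    rw [← tσ_eq] at h3
    have h4 := hacc k hk0 hk 0 ⟨le_rfl, mul_nonneg (Nat.cast_nonneg _) (dt_pos hT hn).le⟩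
    have h5 : (P.tσ k - 0) / P.T = P.dt / P.T * (k + P.σ k) := by rw [tσ_eq]; ring
    have h6 : ∑ i ∈ Finset.Ioc P.Nlo P.Nhi, P.θ k i * Real.exp (-P.lam i * (P.tσ k - 0) / P.T)
        = P.expSum k (k + P.σ k) := by
      refine Finset.sum_congr rfl fun i _ => ?_
      rw [rate, tσ_eq]
      congr 2
      ring
    rw [h5, h6] at h4
    have h7 := (abs_le.1 h4).2
    rw [h1, ← h3]
    rw [Nat.cast_zero, sub_zero] at h2
    refine le_trans ?_ h2
    have := mul_le_mul_of_nonneg_left h7 (pref_pos hT hα1).le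
    linarith

/-- Bounding the correction in the earlier weight by `histB (l+1) l`, which also occurs in the last
weight, leaves a surplus of `(σ² - (2σ - 1)) histB = (α²/4) histB`, as covered by `histA_last_le`.
-/
theorem weight_last (hT : 0 < P.T) (hn : 0 < P.n) (hh : 0 < P.h) (hY : 2 ≤ 2 * Real.pi / P.h)
    {l : ℕ} (hα : 0 < P.ασ (l + 1)) (hα1 : P.ασ (l + 1) < 1)
    (hσ : P.σ (l + 1) = 1 - P.ασ (l + 1) / 2) :
    P.σ (l + 1) ^ 2 * P.weight (l + 1) l
      ≤ (2 * P.σ (l + 1) - 1) * P.weight (l + 1) (l + 1) := by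
  have h1 := histA_last_le hT hn hh hY hα hα1 hσ
  have h2 : P.weight (l + 1) l ≤ P.histA (l + 1) l + P.histB (l + 1) l := by
    rw [weight.eq_def, if_pos (Nat.lt_succ_self l)]
    cases l with
    | zero => simpa using histB_nonneg hT hn hh hα hα1 0
    | succ l => simpa using histB_le_succ hT hn hh hα hα1 l
  have h3 : P.weight (l + 1) (l + 1) = P.localWeight (l + 1) + P.histB (l + 1) l := by
    simp [weight]
  have h4 := mul_le_mul_of_nonneg_left h2 (sq_nonneg (P.σ (l + 1)))
  rw [h3]
  have h5 : P.σ (l + 1) ^ 2 = 1 - P.ασ (l + 1) + P.ασ (l + 1) ^ 2 / 4 := by rw [hσ]; ring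
  have h6 : 2 * P.σ (l + 1) - 1 = 1 - P.ασ (l + 1) := by rw [hσ]; ring
  rw [h6]
  refine h4.trans ?_
  have h7 : P.σ (l + 1) ^ 2 * P.histB (l + 1) l
      = (1 - P.ασ (l + 1) + P.ασ (l + 1) ^ 2 / 4) * P.histB (l + 1) l := by rw [h5]
  linarith

/-- Inside the history, a later cell has a shorter lag and larger exponentials. The step to the
local weight follows from `weight_last` and `2σ - 1 ≤ σ²`. -/
theorem weight_le_succ (hT : 0 < P.T) (hn : 0 < P.n) (hh : 0 < P.h)
    (hY : 2 ≤ 2 * Real.pi / P.h) {k : ℕ} (hα : 0 < P.ασ k) (hα1 : P.ασ k < 1)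
    (hσ : P.σ k = 1 - P.ασ k / 2) {j : ℕ} (hj : j < k) : P.weight k j ≤ P.weight k (j + 1) := by
  rcases Nat.lt_or_ge (j + 1) k with h | h
  · have hA := histA_le_succ hT hn hh hα hα1 j
    rw [weight.eq_def, weight.eq_def, if_pos hj, if_pos h]
    refine add_le_add hA ?_
    cases j with
    | zero => exact histB_nonneg hT hn hh hα hα1 0
    | succ j => exact histB_le_succ hT hn hh hα hα1 j
  · obtain rfl : k = j + 1 := by omega
    have h1 := weight_last hT hn hh hY hα hα1 hσ
    have hσ0 : 0 < P.σ (j + 1) := by linarith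
    have h2 : 0 ≤ P.weight (j + 1) (j + 1) := by
      have hB := histB_nonneg hT hn hh hα hα1 j
      have hL : 0 ≤ P.localWeight (j + 1) :=
        mul_nonneg (div_nonneg (Real.rpow_nonneg (dt_pos hT hn).le _)
          (Real.Gamma_pos_of_pos (by linarith)).le) (Real.rpow_nonneg hσ0.le _)
      simpa [weight] using add_nonneg hL hB
    have h3 : (2 * P.σ (j + 1) - 1) * P.weight (j + 1) (j + 1)
        ≤ P.σ (j + 1) ^ 2 * P.weight (j + 1) (j + 1) :=
      mul_le_mul_of_nonneg_right (by nlinarith [sq_nonneg (P.σ (j + 1) - 1)]) h2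
    exact le_of_mul_le_mul_left (h1.trans h3) (by positivity)

end TimeData

end FL2

end

/-! ### Assembly of the stability estimate. -/

theorem mainTheorem1 (d : ℕ) (hd : 1 ≤ d)
    (g : FL2.Grid d) (hbox : ∀ i, g.aL i < g.aR i) (hm : ∀ i, 0 < g.m i)
    (P : FL2.TimeData) (hT : 1 ≤ P.T) (hn : 0 < P.n)
    (αmin αmax : ℝ) (hαmin : 0 < αmin) (hαmax : αmax < 1)
    (hα : ∀ t ∈ Set.Icc 0 P.T, P.α t ∈ Set.Icc αmin αmax)
    (hσ : P.IsOffset)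
    (ε : ℝ) (hε0 : 0 < ε) (hε1 : ε ≤ 1 / Real.exp 1)
    (hh : P.h = FL2.quadStep αmax ε) (hacc : P.HasAccuracy ε)
    (hεsmall : ε ≤ FL2.toleranceBound αmin αmax P.dt)
    (φ : (Fin d → ℝ) → ℝ) (f : (Fin d → ℝ) → ℝ → ℝ)
    (u : ℕ → (Fin d → ℤ) → ℝ) (hu : g.IsSolution P φ f u) :
    ∀ k ≤ P.n,
      g.normA (u k) ^ 2 ≤ g.normA (u 0) ^ 2
        + (3 / 2 : ℝ) ^ (d - 1) * (1 / (1 - ε)) * P.c₁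
          * ⨆ l : Fin k, g.norm (g.avgAll (g.source P f l)) ^ 2 := by
  intro K hK
  have hT0 : 0 < P.T := by linarith
  have hαmax0 : 0 ≤ αmax := by
    obtain ⟨h1, h2⟩ := hα 0 ⟨le_rfl, hT0.le⟩
    linarith
  obtain ⟨hh0, hY⟩ := FL2.two_le_two_pi_div_quadStep hαmax0 hε0 hε1
  rw [← hh] at hh0 hY
  have hε : ε < 1 := by
    refine hε1.trans_lt ?_
    rw [one_div, inv_lt_one₀ (Real.exp_pos 1)]
    linarith [Real.exp_one_gt_d9]
  have htmem : ∀ k < P.n, P.tσ k ∈ Set.Ioc 0 P.T := fun k hk =>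
    FL2.TimeData.tσ_mem_Ioc hT0 hk (by linarith [(hσ k hk).1]) (hσ k hk).2.1
  have hασ : ∀ k < P.n, 0 < P.ασ k ∧ P.ασ k < 1 := fun k hk => by
    obtain ⟨h1, h2⟩ := hα _ (Set.Ioc_subset_Icc_self (htmem k hk))
    exact ⟨hαmin.trans_le h1, h2.trans_lt hαmax⟩
  have hσeq : ∀ k < P.n, P.σ k = 1 - P.ασ k / 2 := fun k hk => (hσ k hk).2.2
  have hbdd := FL2.TimeData.bddAbove_rpow_mul_Gamma hT hαmin hαmax hα
  have hc₁ : ∀ k < P.n, 0 < P.tσ k ^ P.ασ k * Real.Gamma (1 - P.ασ k) ∧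
      P.tσ k ^ P.ασ k * Real.Gamma (1 - P.ασ k) ≤ P.c₁ := fun k hk =>
    ⟨mul_pos (Real.rpow_pos_of_pos (htmem k hk).1 _)
      (Real.Gamma_pos_of_pos (by linarith [(hασ k hk).2])),
      le_csSup hbdd ⟨_, Set.Ioc_subset_Icc_self (htmem k hk), rfl⟩⟩
  have hc₁0 : 0 < P.c₁ := (hc₁ 0 hn).1.trans_le (hc₁ 0 hn).2
  have hw0 : ∀ k < P.n, (1 - ε) / P.c₁ ≤ P.weight k 0 := fun k hk => by
    refine le_trans ?_ (FL2.TimeData.weight_zero_ge hT0 hh0 hε0.le hacc hk (hασ k hk).1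
      (hασ k hk).2 (hσeq k hk))
    have h1 := one_div_le_one_div_of_le (hc₁ k hk).1 (hc₁ k hk).2
    rw [Real.rpow_neg (htmem k hk).1.le, ← one_div, div_div, div_eq_mul_one_div]
    exact mul_le_mul_of_nonneg_left h1 (by linarith)
  have hc : 0 < (1 - ε) / P.c₁ := div_pos (by linarith) hc₁0
  have hdx := FL2.Grid.dx_pos hbox hm
  have hgram := FL2.Grid.gram_posSemidef hdx
  have hBapp : ∀ x y, Matrix.toBilin' g.gram x y = x ⬝ᵥ g.gram.mulVec y :=
    fun x y => Matrix.toBilin'_apply' _ _ _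
  have hsymm : ∀ x y, Matrix.toBilin' g.gram x y = Matrix.toBilin' g.gram y x := fun x y => by
    rw [hBapp, hBapp, Matrix.dotProduct_mulVec, ← Matrix.mulVec_transpose,
      FL2.Grid.transpose_eq_of_nonneg (Matrix.nonneg_iff_posSemidef.2 hgram), dotProduct_comm]
  have hpos : ∀ x, 0 ≤ Matrix.toBilin' g.gram x x := fun x => by
    rw [hBapp]
    simpa using hgram.dotProduct_mulVec_nonneg x
  have hvan : ∀ k ≤ P.n, g.VanishesOn ∅ (u k) := fun k hk j hj _ => hu.boundary k hk j hj
  have hnormA : ∀ k ≤ P.n, g.normA (u k) ^ 2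
      = Matrix.toBilin' g.gram (g.res (u k)) (g.res (u k)) := fun k hk => by
    have h1 : g.ipA (u k) (u k) = Matrix.toBilin' g.gram (g.res (u k)) (g.res (u k)) := by
      rw [FL2.Grid.ipA_eq (hvan k hk) (hvan k hk), hBapp]
    rw [FL2.Grid.normA, h1, Real.sq_sqrt (hpos _)]
  -- For `K = 0` the real supremum over the empty type is 0.
  set M : ℝ := ⨆ l : Fin K, g.norm (g.avgAll (g.source P f l)) ^ 2 with hM
  have hM0 : 0 ≤ M := Real.iSup_nonneg fun l => sq_nonneg _
  have hstep : ∀ k < K, ∑ j ∈ Finset.range (k + 1), P.weight k j *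
      (Matrix.toBilin' g.gram (g.res (u (j + 1))) (g.res (u (j + 1)))
        - Matrix.toBilin' g.gram (g.res (u j)) (g.res (u j)))
      ≤ 1 / 2 * (3 / 2 : ℝ) ^ (d - 1) * M := by
    intro k hkK
    have hk : k < P.n := by omega
    have hσk := hσ k hk
    have hαk := hασ k hk
    have hmono : ∀ j < k, P.weight k j ≤ P.weight k (j + 1) := fun j hj =>
      FL2.TimeData.weight_le_succ hT0 hn hh0 hY hαk.1 hαk.2 (hσeq k hk) hj
    have hge : ∀ j ≤ k, 0 ≤ P.weight k j := by
      intro j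
      induction j with
      | zero => exact fun _ => hc.le.trans (hw0 k hk)
      | succ j ih => exact fun hj => (ih (by omega)).trans (hmono j (by omega))
    have h1 := FL2.sum_sub_le_two_mul_form (Matrix.toBilin' g.gram) hsymm hpos
      (fun j => g.res (u j)) (G := P.weight k) (k := k) (σ := P.σ k) (hge 0 (Nat.zero_le k)) hmono
      (mul_nonneg (by linarith [hσk.1]) (hge k le_rfl)) (by
        rintro l rfl
        exact FL2.TimeData.weight_last hT0 hn hh0 hY hαk.1 hαk.2 (hσeq _ hk))
    refine h1.trans ?_
    set w : (Fin d → ℤ) → ℝ := fun i => P.σ k * u (k + 1) i + (1 - P.σ k) * u k i with hw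
    set D : (Fin d → ℤ) → ℝ := fun i => P.fastDeriv (fun l => u l i) k with hD
    have hwv : g.VanishesOn ∅ w := fun j hj h => by
      simp only [hw]
      rw [hvan (k + 1) hk j hj h, hvan k hk.le j hj h]
      ring
    have hDv : g.VanishesOn ∅ D := fun j hj h => by
      simp only [hD]
      rw [FL2.TimeData.fastDeriv_eq_sum]
      refine Finset.sum_eq_zero fun i hi => ?_
      have := Finset.mem_range.1 hi
      rw [hvan (i + 1) (by omega) j hj h, hvan i (by omega) j hj h]
      ring
    have hwr : g.res w = P.σ k • g.res (u (k + 1)) + (1 - P.σ k) • g.res (u k) := rfl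
    have hDr : g.res D
        = ∑ j ∈ Finset.range (k + 1), P.weight k j • (g.res (u (j + 1)) - g.res (u j)) := by
      funext i
      rw [Finset.sum_apply]
      exact P.fastDeriv_eq_sum _ k
    have h2 := FL2.Grid.ipA_le_of_compact_eq hdx hwv (D := D) (F := g.avgAll (g.source P f k))
      (hu.step k hk)
    rw [FL2.Grid.ipA_eq hDv hwv, ← hBapp, hDr, hwr] at h2
    have h3 : g.ip (g.avgAll (g.source P f k)) (g.avgAll (g.source P f k)) ≤ M := by
      have h4 := le_ciSup (f := fun l : Fin K => g.norm (g.avgAll (g.source P f l)) ^ 2)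
        (Set.finite_range _).bddAbove ⟨k, hkK⟩
      simp only [FL2.Grid.norm] at h4
      rwa [Real.sq_sqrt (FL2.Grid.ip_self_nonneg hdx _)] at h4
    have h5 : 1 / 4 * (3 / 2 : ℝ) ^ (d - 1)
          * g.ip (g.avgAll (g.source P f k)) (g.avgAll (g.source P f k))
        ≤ 1 / 4 * (3 / 2 : ℝ) ^ (d - 1) * M := mul_le_mul_of_nonneg_left h3 (by positivity)
    linarith
  -- The horizon is `K`, not `P.n`, so that only sources with index below `K` enter.
  have hfin := FL2.le_add_div_of_sum_le (n := K) (G := P.weight)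
    (E := fun j => Matrix.toBilin' g.gram (g.res (u j)) (g.res (u j))) hc
    (R := 1 / 2 * (3 / 2 : ℝ) ^ (d - 1) * M) (by positivity)
    (fun k hk => hw0 k (by omega))
    (fun k hk j hj => FL2.TimeData.weight_le_succ hT0 hn hh0 hY (hασ k (by omega)).1
      (hασ k (by omega)).2 (hσeq k (by omega)) hj) hstep K le_rfl
  rw [hnormA K hK, hnormA 0 (Nat.zero_le _)]
  refine hfin.trans (add_le_add le_rfl ?_)
  have h1 : 0 < 1 - ε := by linarith
  -- The argument yields half of the stated source constant; the other half is discarded.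
  have h2 : 1 / 2 * (3 / 2 : ℝ) ^ (d - 1) * M / ((1 - ε) / P.c₁)
      = 1 / 2 * ((3 / 2 : ℝ) ^ (d - 1) * (1 / (1 - ε)) * P.c₁ * M) := by
    field_simp
  rw [h2]
  have h3 : 0 ≤ (3 / 2 : ℝ) ^ (d - 1) * (1 / (1 - ε)) * P.c₁ * M := by positivity
  linarith
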